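/- **Conventions.** All distributions are probability distributions on $\mathbb{R}$ supported on $[0,\infty)$, $\overline F(x)=F((x,\infty))$, $F^{*k}$ is the $k$-fold convolution of $F$ ($F^{*0}$ is the unit mass at $0$), and all limits are for $x\to\infty$. For $\gamma\ge 0$, $F\in\mathcal L(\gamma)$ means that $\overline F(x)>0$ for all $x$ and $\overline F(x-t)/\overline F(x)\to e^{\gamma t}$ for all $t$. If $\gamma>0$ and $F$ is lattice, i.e. carried by $d\mathbb Z$ for a largest $d>0$, then in this definition and in (A) below, applied there to the distribution concerned, $x$ and $t$ are restricted to multiples of the span $d$. Further, $F\in\mathcal{OS}$ means that $\overline F(x)>0$ for all $x$ and $C^*(F)=\limsup \overline{F^{*2}}(x)/\overline F(x)<\infty$. Put $m(F)=\int_0^\infty e^{\gamma y}F(dy)$. **Theorem.** Let $n\ge1$ be an integer, $\gamma\ge0$, and let $F$ be a distribution with $F^{*n}\in\mathcal L(\gamma)\cap\mathcal{OS}$. Let $\tau$ be a random variable with values in $\{0,1,2,\dots\}$, $p_k=P(\tau=k)$, with $P(\tau\ge n)>0$, such that for some $\varepsilon_0>0$ $$\sum_{m=1}^\infty\Big(\sum_{k=(m-1)n+1}^{mn}p_k\Big)\big(C^*(F^{*n})-m(F^{*n})+\varepsilon_0\big)^m<\infty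 .$$ Suppose that at least one of the following holds: (A) $\liminf \overline{F^{*i}}(x-t)/\overline{F^{*i}}(x)\ge e^{\gamma t}$ for all $t>0$ and all $1\le i\le n-1$; (B) $\overline F(x)=o\big(\overline{F^{*2}}(x)\big)$. Then the random convolution $F^{*\tau}=\sum_{k=0}^\infty p_kF^{*k}$ belongs to $\mathcal L(\gamma)\cap\mathcal{OS}$, and $$\limsup\frac{\overline{F^{*\tau}}(x)}{\overline{F^{*n}}(x)}\le\sum_{m=1}^\infty\Big(\sum_{k=(m-1)n+1}^{mn}p_k\Big)\sum_{i=0}^{m-1}\big(m(F^{*n})\big)^i\big(C^*(F^{*n})-m(F^{*n})\big)^{m-1-i}.$$ -/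

import Mathlib

open MeasureTheory Filter Topology Asymptotics Set
open scoped ENNReal

namespace ConvTail

/-- A (probability) distribution on `ℝ` supported on the nonnegative half line `[0, ∞)`. -/
structure IsHalfLineDist (F : Measure ℝ) : Prop where
  prob : IsProbabilityMeasure F
  nonneg : F (Iio 0) = 0

/-- The tail `F̄(x) = F((x, ∞))`. -/
noncomputable def tail (F : Measure ℝ) (x : ℝ) : ℝ≥0∞ := F (Ioi x)

/-- The `k`-fold convolution `F^{*k}`, where `F^{*0}` is the unit mass at `0`. -/
noncomputable def convPow (F : Measure ℝ) : ℕ → Measure ℝ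
  | 0 => Measure.dirac 0
  | k + 1 => (convPow F k).conv F

/-- The random convolution `F^{*τ} = ∑ₖ P(τ = k) F^{*k}`. -/
noncomputable def randomConv {Ω : Type*} [MeasurableSpace Ω] (P : Measure Ω) (τ : Ω → ℕ)
    (F : Measure ℝ) : Measure ℝ :=
  Measure.sum fun k => P {ω | τ ω = k} • convPow F k

/-- `F` is a lattice distribution with span `d`: it is carried by `dℤ`, and `d > 0` is the largest
number with that property. -/
def HasLatticeSpan (F : Measure ℝ) (d : ℝ) : Prop :=
  IsGreatest {r : ℝ | 0 < r ∧ ∀ᵐ x ∂F, ∃ k : ℤ, x = k * r} d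

/-- The values to which the arguments `x` and the shifts `t` are restricted in asymptotic relations
of index `γ` for the tail of `F`: the multiples of the lattice span if `γ > 0` and `F` is lattice,
and all real numbers otherwise. -/
def argValues (γ : ℝ) (F : Measure ℝ) : Set ℝ :=
  {x | ∀ d : ℝ, 0 < γ → HasLatticeSpan F d → ∃ k : ℤ, x = k * d}

/-- The filter `x → ∞` along `argValues γ F`. -/
def argAtTop (γ : ℝ) (F : Measure ℝ) : Filter ℝ := atTop ⊓ 𝓟 (argValues γ F)

/-- The class `𝓛(γ)`: distributions with a positive tail and `F̄(x - t) ∼ e^{γt} F̄(x)` as `x → ∞`,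
for all `t`. -/
structure ClassL (γ : ℝ) (F : Measure ℝ) : Prop where
  dist : IsHalfLineDist F
  tail_pos : ∀ x, 0 < tail F x
  tendsto : ∀ t ∈ argValues γ F,
    Tendsto (fun x => tail F (x - t) / tail F x) (argAtTop γ F)
      (𝓝 (ENNReal.ofReal (Real.exp (γ * t))))

/-- `C*(F) = limsup F̄^{*2}(x) / F̄(x)`. -/
noncomputable def cStar (F : Measure ℝ) : ℝ≥0∞ :=
  limsup (fun x => tail (convPow F 2) x / tail F x) atTop

/-- The class `𝓞𝓢`: distributions with a positive tail and `C*(F) < ∞`. -/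
structure ClassOS (F : Measure ℝ) : Prop where
  dist : IsHalfLineDist F
  tail_pos : ∀ x, 0 < tail F x
  cStar_lt_top : cStar F < ∞

/-- `m(F) = ∫₀^∞ e^{γy} F(dy)`, possibly infinite. -/
noncomputable def expMoment (γ : ℝ) (F : Measure ℝ) : ℝ≥0∞ :=
  ∫⁻ y in Ici 0, ENNReal.ofReal (Real.exp (γ * y)) ∂F

/-- `liminf F̄(x - t) / F̄(x) ≥ e^{γt}` for all `t > 0`. -/
def TailLiminf (γ : ℝ) (F : Measure ℝ) : Prop :=
  ∀ t ∈ argValues γ F, 0 < t →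
    ENNReal.ofReal (Real.exp (γ * t)) ≤
      liminf (fun x => tail F (x - t) / tail F x) (argAtTop γ F)

/-- `F̄(x) = o(F̄^{*2}(x))`. -/
def TailLittleO (F : Measure ℝ) : Prop :=
  (fun x => (tail F x).toReal) =o[atTop] fun x => (tail (convPow F 2) x).toReal

end ConvTail

/-!
The idea is to compare all tails with the tail of `G = F^{*n}`, which is regular:
`Ḡ(x - t) ∼ e^{γt} Ḡ(x)` and the tail of `G ∗ G` is `O(Ḡ)`. By
`ConvTail.RegularTail.expMoment_add_one_le_cStar` the exponential moment `m(G)` is finite, so that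
two large summands contribute only `o(Ḡ)` to a convolution of tails of order `Ḡ`
(`ConvTail.RegularTail.exists_cross_term_le`).

*Membership in `𝓛(γ)`.* The relation `S̄(x - t) = e^{γt} S̄(x) + o(Ḡ(x))` is split into two
inequalities, `TailLower` and `TailUpper`, each of which is stable under convolution
(`RegularTail.lower_conv`, `RegularTail.upper_conv`). For `n ≥ 2`, the liminf condition with `i = 1`
is the lower one for `F`, and the lower one follows for all `F^{*k}`. Since equality holds
asymptotically for `G = F ∗ F^{*(n-1)}`, the upper one holds for `F` as well
(`RegularTail.upper_of_conv_eq`): a defect of `F` near some point, multiplied by the mass that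
`F^{*(n-1)}` gives to a short interval, would be a defect of `G`. So both hold for all `F^{*k}`, and
they can be summed over `k`.

*Domination and the bound.* Splitting a convolution according to the size of one summand gives the
recursion `a_{k+1} = (C*(G) - m(G)) a_k + m(G)^{k+1}` for asymptotic bounds `a_k` of the ratios of
the tails of `G^{*(k+1)}` and `G` (`RegularTail.eventually_tail_convPow_le`), and a geometric bound
with any ratio above `C*(G) - m(G)` that is uniform in `x` (`RegularTail.exists_kesten_bound`).
As `F^{*k}` has a lighter tail than `G^{*m}` for `k ≤ mn`, the assumption on `τ` permits summation
over blocks of length `n`.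

*The condition `F̄ = o(F̄^{*2})`.* It cannot hold together with the assumptions on `F^{*n}`: they
make `γ` the critical exponent of `F` with `m(F) < ∞`, and then the ratio of the tails of `F^{*2}`
and `F` does not tend to infinity (`ConvTail.not_tailLittleO`). No separate argument is therefore required
for this alternative.

*Lattices.* If `γ > 0` and `G` has span `d`, the liminf condition forces `F` itself to be carried
by `dℤ` (`ConvTail.TailLiminf.ae_mem_zmultiples`), and the random convolution has span `d`
again. Limits along `dℤ` extend to all real `x` because the tails are constant between lattice
points, so the asymptotic arguments take place on the whole line, and only the shifts `t` are
restricted, to a subgroup `V` of `ℝ`.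
-/

namespace ConvTail

/-! ### Tails of convolutions -/

lemma tail_antitone (F : Measure ℝ) : Antitone (tail F) :=
  fun _ _ h => measure_mono (Ioi_subset_Ioi h)

@[fun_prop]
lemma measurable_tail (F : Measure ℝ) : Measurable (tail F) := (tail_antitone F).measurable

lemma tail_le_one (F : Measure ℝ) [IsProbabilityMeasure F] (x : ℝ) : tail F x ≤ 1 := prob_le_one

lemma tail_ne_top (F : Measure ℝ) [IsFiniteMeasure F] (x : ℝ) : tail F x ≠ ∞ :=
  measure_ne_top _ _

lemma IsHalfLineDist.ae_nonneg {F : Measure ℝ} (hF : IsHalfLineDist F) : ∀ᵐ x ∂F, 0 ≤ x := by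
  rw [ae_iff]
  simpa [Iio] using hF.nonneg

lemma tail_conv (S T : Measure ℝ) [SFinite S] [SFinite T] (x : ℝ) :
    tail (S.conv T) x = ∫⁻ y, tail S (x - y) ∂T := by
  rw [Measure.conv_comm, tail, ← lintegral_indicator_one measurableSet_Ioi,
    Measure.lintegral_conv (measurable_one.indicator measurableSet_Ioi)]
  refine lintegral_congr fun y => ?_
  rw [tail, ← lintegral_indicator_one measurableSet_Ioi]
  refine lintegral_congr fun s => ?_
  simp only [indicator, mem_Ioi, sub_lt_iff_lt_add', Pi.one_apply]

/-- The tail of a convolution, split according to whether the second summand is at most `x - A`.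
On the complementary event the sum exceeds `x` automatically once the first summand is at
least `A`, which accounts for the minimum. -/
lemma tail_conv_split (S T : Measure ℝ) [IsFiniteMeasure S] [IsFiniteMeasure T] (A x : ℝ) :
    tail (S.conv T) x =
      ∫⁻ y in Iic (x - A), tail S (x - y) ∂T + ∫⁻ s, tail T (x - min s A) ∂S := by
  rw [tail_conv, ← lintegral_add_compl _ (measurableSet_Iic (a := x - A)), compl_Iic]
  congr 1
  rw [← tail_conv S, Measure.conv_comm, tail_conv]
  refine lintegral_congr fun s => ?_
  rw [tail, Measure.restrict_apply measurableSet_Ioi, Ioi_inter_Ioi, tail]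
  congr 2
  rcases le_total s A with h | h <;> simp [h] <;> linarith

lemma setLIntegral_tail_le_tail_conv (S T : Measure ℝ) [SFinite S] [SFinite T] (x : ℝ)
    (B : Set ℝ) : ∫⁻ y in B, tail S (x - y) ∂T ≤ tail (S.conv T) x := by
  rw [tail_conv]
  exact setLIntegral_le_lintegral _ _

/-- Convolution preserves domination of tails (on the whole line). -/
lemma tail_conv_le_mul {S S' : Measure ℝ} [SFinite S] [SFinite S'] (T : Measure ℝ) [SFinite T]
    {C : ℝ≥0∞} (h : ∀ x, tail S x ≤ C * tail S' x) (x : ℝ) :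
    tail (S.conv T) x ≤ C * tail (S'.conv T) x := by
  rw [tail_conv, tail_conv, ← lintegral_const_mul _ (by fun_prop)]
  exact lintegral_mono fun y => h _

lemma IsHalfLineDist.conv {S T : Measure ℝ} (hS : IsHalfLineDist S) (hT : IsHalfLineDist T) :
    IsHalfLineDist (S.conv T) := by
  have := hS.prob
  have := hT.prob
  refine ⟨inferInstance, ?_⟩
  have h1 : ∀ᵐ p ∂S.prod T, 0 ≤ p.1 := Measure.quasiMeasurePreserving_fst.ae hS.ae_nonneg
  have h2 : ∀ᵐ p ∂S.prod T, 0 ≤ p.2 := Measure.quasiMeasurePreserving_snd.ae hT.ae_nonneg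
  rw [Measure.conv, Measure.map_apply (by fun_prop) measurableSet_Iio]
  refine measure_mono_null ?_ (ae_iff.1 (h1.and h2))
  rintro ⟨a, b⟩ hab
  simp only [mem_preimage, mem_Iio] at hab
  simp only [mem_ofPred_eq, not_and_or, not_le]
  by_contra! hc
  linarith

lemma tail_le_tail_conv {S T : Measure ℝ} [SFinite S] (hT : IsHalfLineDist T) (x : ℝ) :
    tail S x ≤ tail (S.conv T) x := by
  have := hT.prob
  rw [tail_conv]
  calc tail S x = ∫⁻ _, tail S x ∂T := by simp
    _ ≤ _ := lintegral_mono_ae (hT.ae_nonneg.mono fun y hy => tail_antitone S (by linarith))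

lemma isHalfLineDist_dirac_zero : IsHalfLineDist (Measure.dirac 0) :=
  ⟨inferInstance, by simp⟩

/-! ### Convolution powers -/

lemma isHalfLineDist_convPow {F : Measure ℝ} (hF : IsHalfLineDist F) (k : ℕ) :
    IsHalfLineDist (convPow F k) := by
  induction k with
  | zero => exact isHalfLineDist_dirac_zero
  | succ k ih => exact ih.conv hF

instance instIsProbabilityMeasureConvPow (F : Measure ℝ) [IsProbabilityMeasure F] (k : ℕ) :
    IsProbabilityMeasure (convPow F k) := by
  induction k with
  | zero => exact inferInstanceAs (IsProbabilityMeasure (Measure.dirac 0))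
  | succ k ih => exact inferInstanceAs (IsProbabilityMeasure ((convPow F k).conv F))

lemma convPow_one (F : Measure ℝ) [SFinite F] : convPow F 1 = F := by
  simp [convPow]

lemma convPow_two (F : Measure ℝ) [SFinite F] : convPow F 2 = F.conv F := by
  rw [convPow, convPow_one]

lemma convPow_add (F : Measure ℝ) [IsProbabilityMeasure F] (a b : ℕ) :
    convPow F (a + b) = (convPow F a).conv (convPow F b) := by
  induction b with
  | zero => simp [convPow]
  | succ b ih => rw [← add_assoc, convPow, ih, convPow, Measure.conv_assoc]

lemma convPow_mul (F : Measure ℝ) [IsProbabilityMeasure F] (n m : ℕ) :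
    convPow F (m * n) = convPow (convPow F n) m := by
  induction m with
  | zero => simp [convPow]
  | succ m ih => rw [add_mul, one_mul, convPow_add, ih, convPow]

lemma tail_convPow_mono {F : Measure ℝ} (hF : IsHalfLineDist F) (x : ℝ) :
    Monotone fun k => tail (convPow F k) x := by
  have := hF.prob
  exact monotone_nat_of_le_succ fun k => tail_le_tail_conv hF x

/-! ### Exponential moments -/

lemma expMoment_eq (γ : ℝ) {F : Measure ℝ} (hF : IsHalfLineDist F) :
    expMoment γ F = ∫⁻ y, ENNReal.ofReal (Real.exp (γ * y)) ∂F := by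
  rw [expMoment]
  congr 1
  refine Measure.restrict_eq_self_of_ae_mem ?_
  exact hF.ae_nonneg

lemma expMoment_conv (γ : ℝ) {S T : Measure ℝ} (hS : IsHalfLineDist S) (hT : IsHalfLineDist T) :
    expMoment γ (S.conv T) = expMoment γ S * expMoment γ T := by
  have := hS.prob
  have := hT.prob
  rw [expMoment_eq γ hS, expMoment_eq γ hT, expMoment_eq γ (hS.conv hT),
    Measure.lintegral_conv (by fun_prop), ← lintegral_mul_const _ (by fun_prop)]
  refine lintegral_congr fun x => ?_
  rw [← lintegral_const_mul _ (by fun_prop)]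
  refine lintegral_congr fun y => ?_
  rw [← ENNReal.ofReal_mul (Real.exp_nonneg _), ← Real.exp_add, mul_add]

lemma expMoment_convPow (γ : ℝ) {F : Measure ℝ} (hF : IsHalfLineDist F) (k : ℕ) :
    expMoment γ (convPow F k) = expMoment γ F ^ k := by
  induction k with
  | zero => simp [convPow, expMoment_eq γ isHalfLineDist_dirac_zero]
  | succ k ih => rw [convPow, expMoment_conv γ (isHalfLineDist_convPow hF k) hF, ih, pow_succ]

lemma one_le_expMoment {γ : ℝ} (hγ : 0 ≤ γ) {F : Measure ℝ} (hF : IsHalfLineDist F) :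
    1 ≤ expMoment γ F := by
  have := hF.prob
  rw [expMoment_eq γ hF]
  calc (1 : ℝ≥0∞) = ∫⁻ _, 1 ∂F := by simp
    _ ≤ _ := lintegral_mono_ae (hF.ae_nonneg.mono fun y hy => by
        simpa using mul_nonneg hγ hy)

/-- Markov's inequality for the exponential moment. -/
lemma exp_mul_tail_le (γ : ℝ) (hγ : 0 ≤ γ) {F : Measure ℝ} (x : ℝ) :
    ENNReal.ofReal (Real.exp (γ * x)) * tail F x ≤
      ∫⁻ y in Ioi x, ENNReal.ofReal (Real.exp (γ * y)) ∂F := by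
  calc ENNReal.ofReal (Real.exp (γ * x)) * tail F x
      = ∫⁻ _ in Ioi x, ENNReal.ofReal (Real.exp (γ * x)) ∂F := by simp [tail]
    _ ≤ _ := setLIntegral_mono' measurableSet_Ioi fun y hy => by
        have : x < y := hy
        gcongr

lemma tail_pos_of_convPow {F : Measure ℝ} (hF : IsHalfLineDist F) {n : ℕ}
    (h : ∀ x, 0 < tail (convPow F n) x) (x : ℝ) : 0 < tail F x := by
  have := hF.prob
  by_contra hx
  have hx0 : tail F x = 0 := by simpa using hx
  have key : ∀ k, tail (convPow F k) (k * max x 0) = 0 := by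
    intro k
    induction k with
    | zero => simp [convPow, tail]
    | succ k ih =>
      rw [convPow, tail_conv, lintegral_eq_zero_iff (by fun_prop)]
      have hb : ∀ᵐ y ∂F, y ≤ x := by
        rw [ae_iff]
        simpa [tail, Ioi] using hx0
      filter_upwards [hb] with y hy
      refine le_antisymm (le_trans (tail_antitone _ ?_) ih.le) zero_le
      have := le_max_left x 0
      push_cast
      linarith
  exact (h _).ne' (key n)

/-! ### The tail of `F` is never negligible with respect to that of `F^{*2}` -/

/-- Tail domination beyond `x₀` passes to integrals of monotone functions. -/
lemma mul_lintegral_le_of_tail_le {μ ν : Measure ℝ} {K : ℝ≥0∞} {x₀ : ℝ}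
    (h : ∀ x, x₀ ≤ x → K * tail ν x ≤ tail μ x) {g : ℝ → ℝ} (hg : Monotone g)
    (hgc : Continuous g) (hg0 : ∀ x, 0 ≤ g x) :
    K * ∫⁻ x, ENNReal.ofReal (g x) ∂ν ≤
      ∫⁻ x, ENNReal.ofReal (g x) ∂μ + K * (ENNReal.ofReal (g x₀) * ν univ) := by
  set f : ℝ → ℝ := fun x => max (g x - g x₀) 0 with hf
  have hfc : Continuous f := by fun_prop
  have hfm : Monotone f := fun a b hab => max_le_max (sub_le_sub_right (hg hab) _) le_rfl
  have hf0 : ∀ x, 0 ≤ f x := fun x => le_max_right _ _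
  have hlevel : ∀ t, 0 < t → K * ν {x | t < f x} ≤ μ {x | t < f x} := by
    intro t ht
    rcases eq_empty_or_nonempty {x | t < f x} with he | hne
    · simp [he]
    have hsub : ∀ x ∈ {x | t < f x}, x₀ < x := by
      intro x hx
      by_contra! hc
      have h1 : f x ≤ f x₀ := hfm hc
      have h2 : f x₀ = 0 := by simp [hf]
      have h3 : t < f x := hx
      linarith
    have hbdd : BddBelow {x | t < f x} := ⟨x₀, fun x hx => (hsub x hx).le⟩
    have hopen : IsOpen {x | t < f x} := isOpen_lt continuous_const hfc
    -- an open upper set that is bounded below is an open half line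
    have heq : {x | t < f x} = Ioi (sInf {x | t < f x}) := by
      ext y
      constructor
      · intro hy
        obtain ⟨z, hzy, hz⟩ := exists_Ioc_subset_of_mem_nhds (hopen.mem_nhds hy) ⟨y - 1, by simp⟩
        obtain ⟨w, hzw, hwy⟩ := exists_between hzy
        exact lt_of_le_of_lt (csInf_le hbdd (hz ⟨hzw, hwy.le⟩)) hwy
      · intro hy
        obtain ⟨z, hz, hzy⟩ := exists_lt_of_csInf_lt hne hy
        exact lt_of_lt_of_le hz (hfm hzy.le)
    rw [heq]
    exact h _ (le_csInf hne fun x hx => (hsub x hx).le)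
  have h1 : K * ∫⁻ x, ENNReal.ofReal (f x) ∂ν ≤ ∫⁻ x, ENNReal.ofReal (f x) ∂μ := by
    rw [lintegral_eq_lintegral_meas_lt ν (.of_forall hf0) hfc.aemeasurable,
      lintegral_eq_lintegral_meas_lt μ (.of_forall hf0) hfc.aemeasurable,
      ← lintegral_const_mul]
    · exact setLIntegral_mono' measurableSet_Ioi fun t ht => hlevel t ht
    · exact Antitone.measurable fun a b hab => measure_mono fun x hx => lt_of_le_of_lt hab hx
  have h2 : ∫⁻ x, ENNReal.ofReal (g x) ∂ν ≤
      ∫⁻ x, ENNReal.ofReal (f x) ∂ν + ENNReal.ofReal (g x₀) * ν univ := by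
    rw [← lintegral_const, ← lintegral_add_right _ measurable_const]
    refine lintegral_mono fun x => ?_
    rw [← ENNReal.ofReal_add (hf0 x) (hg0 x₀)]
    refine ENNReal.ofReal_le_ofReal ?_
    have := le_max_left (g x - g x₀) 0
    simp only [hf]
    linarith
  have h3 : ∫⁻ x, ENNReal.ofReal (f x) ∂μ ≤ ∫⁻ x, ENNReal.ofReal (g x) ∂μ :=
    lintegral_mono fun x => ENNReal.ofReal_le_ofReal
      (max_le (by linarith [hg0 x₀]) (hg0 x))
  calc _ ≤ K * (∫⁻ x, ENNReal.ofReal (f x) ∂ν + ENNReal.ofReal (g x₀) * ν univ) := by gcongr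
    _ ≤ _ := by rw [mul_add]; gcongr; exact h1.trans h3

/-- Truncation of `x` to the interval `[0, A]`. -/
noncomputable def trunc (A : ℕ) (x : ℝ) : ℝ := min (max x 0) A

lemma trunc_nonneg (A : ℕ) (x : ℝ) : 0 ≤ trunc A x := le_min (le_max_right _ _) (Nat.cast_nonneg A)

lemma trunc_le (A : ℕ) (x : ℝ) : trunc A x ≤ A := min_le_right _ _

lemma trunc_mono (A : ℕ) : Monotone (trunc A) :=
  fun _ _ h => min_le_min (max_le_max h le_rfl) le_rfl

@[fun_prop]
lemma continuous_trunc (A : ℕ) : Continuous (trunc A) := by unfold trunc; fun_prop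

lemma trunc_add_le (A : ℕ) (x y : ℝ) : trunc A (x + y) ≤ trunc A x + trunc A y := by
  have hxy : max (x + y) 0 ≤ max x 0 + max y 0 :=
    max_le (add_le_add (le_max_left _ _) (le_max_left _ _))
      (add_nonneg (le_max_right _ _) (le_max_right _ _))
  have hx : 0 ≤ trunc A x := trunc_nonneg A x
  have hy : 0 ≤ trunc A y := trunc_nonneg A y
  have hA : trunc A (x + y) ≤ A := trunc_le A _
  unfold trunc at *
  rcases le_total (max x 0) A with h1 | h1
  · rcases le_total (max y 0) A with h2 | h2
    · rw [min_eq_left h1, min_eq_left h2]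
      exact (min_le_left _ _).trans hxy
    · rw [min_eq_right h2]
      linarith
  · rw [min_eq_right h1]
    linarith

lemma trunc_succ_le (A : ℕ) (x : ℝ) : trunc (A + 1) x ≤ trunc A x + 1 := by
  unfold trunc
  push_cast
  rw [← min_add_add_right]
  exact min_le_min (by linarith) le_rfl

/-- If the exponential moment of index `γ` is finite and those of larger index are infinite, there
are truncation levels at which the truncated moments of index `γ + s` are comparable to the moment
of index `γ`. -/
lemma exists_trunc_level {F : Measure ℝ} (hF : IsHalfLineDist F) {γ s : ℝ} (hs : 0 < s)
    (hs1 : s ≤ 1) (hm : expMoment γ F < ∞) (hinf : expMoment (γ + s) F = ∞) :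
    ∃ A : ℕ, 2 * expMoment γ F < ∫⁻ x, ENNReal.ofReal (Real.exp (γ * x + s * trunc A x)) ∂F ∧
      ∫⁻ x, ENNReal.ofReal (Real.exp (γ * x + s * trunc A x)) ∂F ≤ 6 * expMoment γ F := by
  set φ : ℕ → ℝ≥0∞ := fun A => ∫⁻ x, ENNReal.ofReal (Real.exp (γ * x + s * trunc A x)) ∂F with hφ
  have hlim : Tendsto φ atTop (𝓝 ∞) := by
    rw [← hinf, expMoment_eq _ hF]
    refine lintegral_tendsto_of_tendsto_of_monotone (fun A => by fun_prop) ?_ ?_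
    · refine .of_forall fun x => fun A B hAB => ?_
      have : trunc A x ≤ trunc B x := min_le_min le_rfl (by exact_mod_cast hAB)
      dsimp only
      gcongr
    · filter_upwards [hF.ae_nonneg] with x hx
      refine tendsto_const_nhds.congr' ?_
      filter_upwards [eventually_ge_atTop ⌈x⌉₊] with A hA
      have : trunc A x = x := by
        unfold trunc
        rw [max_eq_left hx, min_eq_left ((Nat.le_ceil x).trans (by exact_mod_cast hA))]
      rw [this, add_mul]
  have hex : ∃ A, 2 * expMoment γ F < φ A :=
    (hlim.eventually (lt_mem_nhds (ENNReal.mul_lt_top (by simp) hm))).exists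
  classical
  refine ⟨Nat.find hex, Nat.find_spec hex, ?_⟩
  have h0 : Nat.find hex ≠ 0 := by
    intro h0
    have h1 := Nat.find_spec hex
    rw [h0] at h1
    have h2 : φ 0 = expMoment γ F := by
      rw [expMoment_eq _ hF]
      simp [hφ, trunc]
    rw [h2] at h1
    exact h1.not_ge (by rw [two_mul]; exact le_add_self)
  obtain ⟨B, hB⟩ := Nat.exists_eq_succ_of_ne_zero h0
  have hBle : φ B ≤ 2 * expMoment γ F := not_lt.1 (Nat.find_min hex (by omega))
  change φ (Nat.find hex) ≤ _
  rw [hB]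
  calc φ (B + 1) ≤ 3 * φ B := by
        rw [hφ]
        dsimp only
        rw [← lintegral_const_mul _ (by fun_prop)]
        refine lintegral_mono fun x => ?_
        have h3 : (3 : ℝ≥0∞) = ENNReal.ofReal 3 := by simp
        rw [h3, ← ENNReal.ofReal_mul (by norm_num)]
        refine ENNReal.ofReal_le_ofReal ?_
        have h4 : Real.exp 1 ≤ 3 := by linarith [Real.exp_one_lt_d9]
        calc Real.exp (γ * x + s * trunc (B + 1) x)
            ≤ Real.exp (1 + (γ * x + s * trunc B x)) := by
              refine Real.exp_le_exp.2 ?_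
              nlinarith [trunc_succ_le B x]
          _ = Real.exp 1 * Real.exp (γ * x + s * trunc B x) := Real.exp_add _ _
          _ ≤ _ := by gcongr
    _ ≤ 3 * (2 * expMoment γ F) := by gcongr
    _ = 6 * expMoment γ F := by rw [← mul_assoc]; norm_num

/-- At its critical exponent `γ`, if `m(F)` is finite, the tail of `F` is not negligible with respect
to that of `F^{*2}`. The test function `g(x) = u e^{γx + su}`, with `u` the truncation of `x`,
satisfies `E g(ξ₁ + ξ₂) ≤ C E g(ξ)` with `C` independent of `s`, whereas
`E g(ξ₁ + ξ₂) ≥ K (E g(ξ) - O(1))` for every `K` if `F̄ = o(F̄^{*2})`; but `E g(ξ)` is unbounded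
as `s → 0`. -/
lemma not_tailLittleO {F : Measure ℝ} (hF : IsHalfLineDist F) {γ : ℝ} (hγ : 0 ≤ γ)
    (hm : expMoment γ F < ∞) (hinf : ∀ s, 0 < s → expMoment (γ + s) F = ∞) : ¬ TailLittleO F := by
  intro hB
  have := hF.prob
  set m := expMoment γ F with hmdef
  have hm1 : 1 ≤ m := one_le_expMoment hγ hF
  have hm0 : m ≠ 0 := (zero_lt_one.trans_le hm1).ne'
  have hmr : 0 < m.toReal := ENNReal.toReal_pos hm0 hm.ne
  -- the constant `24 m` is twice the constant `12 m` of the subadditivity estimate below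
  obtain ⟨x₀, hx₀⟩ := eventually_atTop.1 (hB.bound (c := (24 * m.toReal)⁻¹) (by positivity))
  have hK : ∀ x, x₀ ≤ x → (24 * m) * tail F x ≤ tail (convPow F 2) x := by
    intro x hx
    have h1 := hx₀ x hx
    simp only [Real.norm_eq_abs, abs_of_nonneg ENNReal.toReal_nonneg] at h1
    rw [inv_mul_eq_div, le_div_iff₀ (by positivity)] at h1
    rw [← ENNReal.toReal_le_toReal (ENNReal.mul_ne_top (ENNReal.mul_ne_top (by simp) hm.ne)
      (tail_ne_top F x)) (tail_ne_top _ x)]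
    simp only [ENNReal.toReal_mul, ENNReal.toReal_ofNat]
    linarith
  set B : ℝ := max x₀ 0 * Real.exp (γ * x₀ + max x₀ 0) with hBdef
  have hB0 : 0 ≤ B := by positivity
  set s : ℝ := min 1 (m.toReal / (2 * B + 1)) with hsdef
  have hs : 0 < s := lt_min one_pos (by positivity)
  have hs1 : s ≤ 1 := min_le_left _ _
  obtain ⟨A, hA1, hA2⟩ := exists_trunc_level hF hs hs1 hm (hinf s hs)
  set φ := ∫⁻ x, ENNReal.ofReal (Real.exp (γ * x + s * trunc A x)) ∂F with hφ
  set g : ℝ → ℝ := fun x => trunc A x * Real.exp (γ * x + s * trunc A x) with hg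
  have hg0 : ∀ x, 0 ≤ g x := fun x => mul_nonneg (trunc_nonneg A x) (Real.exp_nonneg _)
  have hgm : Monotone g := by
    intro a b hab
    have h1 := trunc_mono A hab
    have h2 := trunc_nonneg A a
    have h3 := trunc_nonneg A b
    simp only [hg]
    gcongr
  have hgc : Continuous g := by fun_prop
  set E := ∫⁻ x, ENNReal.ofReal (g x) ∂F with hE
  have hφtop : φ < ∞ := hA2.trans_lt (ENNReal.mul_lt_top (by simp) hm)
  have hEtop : E < ∞ := by
    refine lt_of_le_of_lt ?_ (ENNReal.mul_lt_top (ENNReal.natCast_lt_top A) hφtop)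
    rw [hφ, ← lintegral_const_mul _ (by fun_prop)]
    refine lintegral_mono fun x => ?_
    rw [← ENNReal.ofReal_natCast, ← ENNReal.ofReal_mul (Nat.cast_nonneg A)]
    exact ENNReal.ofReal_le_ofReal (mul_le_mul_of_nonneg_right (trunc_le A x) (Real.exp_nonneg _))
  have hlow : φ ≤ m + ENNReal.ofReal s * E := by
    rw [hmdef, expMoment_eq γ hF, hE, ← lintegral_const_mul _ (by fun_prop),
      ← lintegral_add_left (by fun_prop)]
    refine lintegral_mono fun x => ?_
    rw [← ENNReal.ofReal_mul hs.le,
      ← ENNReal.ofReal_add (Real.exp_nonneg _) (mul_nonneg hs.le (hg0 x))]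
    refine ENNReal.ofReal_le_ofReal ?_
    simp only [hg]
    rw [Real.exp_add]
    -- `e^v ≤ 1 + v e^v` with `v = s u`
    have h1 : Real.exp (s * trunc A x) ≤ 1 + s * trunc A x * Real.exp (s * trunc A x) := by
      have h2 := Real.add_one_le_exp (-(s * trunc A x))
      have h3 := Real.exp_pos (s * trunc A x)
      have h4 : Real.exp (-(s * trunc A x)) * Real.exp (s * trunc A x) = 1 := by
        rw [← Real.exp_add]; simp
      nlinarith
    nlinarith [Real.exp_pos (γ * x)]
  have hup : ∫⁻ x, ENNReal.ofReal (g x) ∂(convPow F 2) ≤ 2 * φ * E := by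
    rw [convPow_two, Measure.lintegral_conv (by fun_prop)]
    calc ∫⁻ x, ∫⁻ y, ENNReal.ofReal (g (x + y)) ∂F ∂F
        ≤ ∫⁻ x, ∫⁻ y, (ENNReal.ofReal (g x) * ENNReal.ofReal (Real.exp (γ * y + s * trunc A y))
            + ENNReal.ofReal (Real.exp (γ * x + s * trunc A x)) * ENNReal.ofReal (g y)) ∂F ∂F := by
          refine lintegral_mono fun x => lintegral_mono fun y => ?_
          rw [← ENNReal.ofReal_mul (hg0 x), ← ENNReal.ofReal_mul (Real.exp_nonneg _),
            ← ENNReal.ofReal_add (mul_nonneg (hg0 x) (Real.exp_nonneg _))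
              (mul_nonneg (Real.exp_nonneg _) (hg0 y))]
          refine ENNReal.ofReal_le_ofReal ?_
          have h1 : Real.exp (γ * (x + y) + s * trunc A (x + y)) ≤
              Real.exp (γ * x + s * trunc A x) * Real.exp (γ * y + s * trunc A y) := by
            rw [← Real.exp_add]
            refine Real.exp_le_exp.2 ?_
            nlinarith [trunc_add_le A x y]
          calc g (x + y) ≤ (trunc A x + trunc A y) *
                (Real.exp (γ * x + s * trunc A x) * Real.exp (γ * y + s * trunc A y)) :=
                mul_le_mul (trunc_add_le A x y) h1 (Real.exp_nonneg _)
                  (add_nonneg (trunc_nonneg A x) (trunc_nonneg A y))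
            _ = _ := by simp only [hg]; ring
      _ = ∫⁻ x, (ENNReal.ofReal (g x) * φ
            + ENNReal.ofReal (Real.exp (γ * x + s * trunc A x)) * E) ∂F := by
          refine lintegral_congr fun x => ?_
          rw [lintegral_add_left (by fun_prop), lintegral_const_mul _ (by fun_prop),
            lintegral_const_mul _ (by fun_prop)]
      _ = 2 * φ * E := by
          rw [lintegral_add_left (by fun_prop), lintegral_mul_const _ (by fun_prop),
            lintegral_mul_const _ (by fun_prop)]
          ring
  have hgx₀ : g x₀ ≤ B := by
    have h1 : trunc A x₀ ≤ max x₀ 0 := min_le_left _ _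
    have h2 := trunc_nonneg A x₀
    simp only [hg, hBdef]
    gcongr
    nlinarith
  have hmain := mul_lintegral_le_of_tail_le hK hgm hgc hg0
  rw [measure_univ, mul_one] at hmain
  have hfin : 24 * m * E ≤ 2 * (6 * m) * E + 24 * m * ENNReal.ofReal B :=
    hmain.trans (by gcongr; exact hup.trans (by gcongr))
  have hfinr : 24 * m.toReal * E.toReal ≤ 2 * (6 * m.toReal) * E.toReal + 24 * m.toReal * B := by
    have h1 := ENNReal.toReal_mono (by finiteness) hfin
    rw [ENNReal.toReal_add (by finiteness) (by finiteness)] at h1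
    simpa [ENNReal.toReal_ofReal hB0] using h1
  have hE2 : E.toReal ≤ 2 * B := by
    by_contra! hc
    nlinarith
  have hmE : m.toReal ≤ s * E.toReal := by
    have h1 : 2 * m ≤ m + ENNReal.ofReal s * E := hA1.le.trans hlow
    have h2 := ENNReal.toReal_mono (by finiteness) h1
    rw [ENNReal.toReal_add (by finiteness) (by finiteness)] at h2
    simp [ENNReal.toReal_ofReal hs.le] at h2
    linarith
  have hs2 : s * (2 * B + 1) ≤ m.toReal := by
    have := min_le_right 1 (m.toReal / (2 * B + 1))
    rwa [← hsdef, le_div_iff₀ (by positivity)] at this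
  nlinarith [ENNReal.toReal_nonneg (a := E)]

/-! ### Distributions carried by cosets of a subgroup -/

lemma mem_zmultiples_real {x r : ℝ} : x ∈ AddSubgroup.zmultiples r ↔ ∃ k : ℤ, x = k * r := by
  simp [AddSubgroup.mem_zmultiples_iff, eq_comm]

lemma measurableSet_zmultiples (d : ℝ) :
    MeasurableSet ((AddSubgroup.zmultiples d : AddSubgroup ℝ) : Set ℝ) :=
  (Set.countable_range fun k : ℤ => k • d).measurableSet

lemma ae_sub_mem_conv {V : AddSubgroup ℝ} (hV : MeasurableSet (V : Set ℝ)) {S T : Measure ℝ}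
    [SFinite S] [SFinite T] {a b : ℝ} (hS : ∀ᵐ x ∂S, x - a ∈ V) (hT : ∀ᵐ x ∂T, x - b ∈ V) :
    ∀ᵐ x ∂S.conv T, x - (a + b) ∈ V := by
  have hm : MeasurableSet {x : ℝ | x - (a + b) ∈ V} :=
    hV.preimage (measurable_id.sub_const (a + b))
  rw [Measure.conv, ae_map_iff (by fun_prop) hm]
  have h1 : ∀ᵐ p ∂S.prod T, p.1 - a ∈ V := Measure.quasiMeasurePreserving_fst.ae hS
  have h2 : ∀ᵐ p ∂S.prod T, p.2 - b ∈ V := Measure.quasiMeasurePreserving_snd.ae hT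
  filter_upwards [h1, h2] with p hp1 hp2
  have := V.add_mem hp1 hp2
  rwa [sub_add_sub_comm] at this

lemma exists_ae_sub_mem_left {V : AddSubgroup ℝ} (hV : MeasurableSet (V : Set ℝ)) {S T : Measure ℝ}
    [IsProbabilityMeasure S] [IsProbabilityMeasure T] (h : ∀ᵐ x ∂S.conv T, x ∈ V) :
    ∃ c, ∀ᵐ x ∂S, x - c ∈ V := by
  rw [Measure.conv_comm, Measure.conv,
    ae_map_iff (p := fun x => x ∈ V) (by fun_prop) hV] at h
  obtain ⟨y, hy⟩ := (Measure.ae_ae_of_ae_prod h).exists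
  refine ⟨-y, hy.mono fun x hx => ?_⟩
  rwa [sub_neg_eq_add, add_comm]

lemma ae_sub_mem_convPow {V : AddSubgroup ℝ} (hV : MeasurableSet (V : Set ℝ)) {F : Measure ℝ}
    [IsProbabilityMeasure F] {c : ℝ} (h : ∀ᵐ x ∂F, x - c ∈ V) (k : ℕ) :
    ∀ᵐ x ∂convPow F k, x - k * c ∈ V := by
  induction k with
  | zero =>
    rw [convPow, ae_dirac_iff]
    · simp
    · exact hV.preimage (by fun_prop)
  | succ k ih =>
    have := ae_sub_mem_conv hV ih h
    rw [convPow]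
    push_cast
    simpa only [add_mul, one_mul] using this

lemma ae_mem_convPow {V : AddSubgroup ℝ} (hV : MeasurableSet (V : Set ℝ)) {F : Measure ℝ}
    [IsProbabilityMeasure F] (h : ∀ᵐ x ∂F, x ∈ V) (k : ℕ) : ∀ᵐ x ∂convPow F k, x ∈ V := by
  simpa using ae_sub_mem_convPow hV (c := 0) (by simpa using h) k

lemma exists_ae_sub_mem_of_convPow {V : AddSubgroup ℝ} (hV : MeasurableSet (V : Set ℝ))
    {F : Measure ℝ} [IsProbabilityMeasure F] {k : ℕ} (hk : 1 ≤ k)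
    (h : ∀ᵐ x ∂convPow F k, x ∈ V) : ∃ c, (∀ᵐ x ∂F, x - c ∈ V) ∧ (k : ℝ) * c ∈ V := by
  obtain ⟨j, rfl⟩ := Nat.exists_eq_add_of_le' hk
  have h' := h
  rw [convPow, Measure.conv_comm] at h'
  obtain ⟨c, hc⟩ := exists_ae_sub_mem_left hV h'
  refine ⟨c, hc, ?_⟩
  obtain ⟨x, hx1, hx2⟩ := (h.and (ae_sub_mem_convPow hV hc (j + 1))).exists
  simpa using V.sub_mem hx1 hx2

/-! ### Lattice spans and the admissible shifts -/

lemma HasLatticeSpan.pos {G : Measure ℝ} {d : ℝ} (h : HasLatticeSpan G d) : 0 < d := h.1.1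

lemma HasLatticeSpan.ae_mem {G : Measure ℝ} {d : ℝ} (h : HasLatticeSpan G d) :
    ∀ᵐ x ∂G, x ∈ AddSubgroup.zmultiples d :=
  h.1.2.mono fun _ hx => mem_zmultiples_real.2 hx

/-- A distribution that is carried by some lattice and charges `(0, ∞)` has a span: all admissible
spans divide the same positive atom. -/
lemma exists_hasLatticeSpan {G : Measure ℝ} (h0 : 0 < tail G 0) {r : ℝ} (hr : 0 < r)
    (h : ∀ᵐ x ∂G, x ∈ AddSubgroup.zmultiples r) : ∃ d, HasLatticeSpan G d := by
  set C : Set ℝ := {x | x ∈ AddSubgroup.zmultiples r ∧ 0 < x}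
  have hC : C.Countable := (Set.countable_range fun k : ℤ => k • r).mono fun x hx => hx.1
  have hCpos : G C ≠ 0 := by
    intro hC0
    refine h0.ne' (measure_mono_null (t := C ∪ {x | ¬ x ∈ AddSubgroup.zmultiples r}) ?_
      (measure_union_null hC0 (ae_iff.1 h)))
    intro x hx
    by_cases hxr : x ∈ AddSubgroup.zmultiples r
    · exact Or.inl ⟨hxr, hx⟩
    · exact Or.inr hxr
  obtain ⟨p, hpC, hp⟩ : ∃ p ∈ C, G {p} ≠ 0 := by
    by_contra! hc
    exact hCpos ((measure_null_iff_singleton hC).2 hc)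
  have hdiv : ∀ q : ℝ, 0 < q → (∀ᵐ x ∂G, ∃ k : ℤ, x = k * q) →
      ∃ k : ℕ, 1 ≤ k ∧ q = p / k := by
    intro q hq hqG
    have : ∃ k : ℤ, p = k * q := by
      by_contra hc
      exact hp (measure_mono_null (by simpa using hc) (ae_iff.1 hqG))
    obtain ⟨k, hk⟩ := this
    have hk0 : (0 : ℝ) < k := by
      by_contra! hc
      have := hpC.2
      nlinarith
    have hk1 : 0 < k := by exact_mod_cast hk0
    lift k to ℕ using hk1.le
    refine ⟨k, by exact_mod_cast hk1, ?_⟩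
    rw [hk]
    push_cast at hk0 ⊢
    field_simp
  have hex : ∃ k : ℕ, 1 ≤ k ∧ ∀ᵐ x ∂G, ∃ j : ℤ, x = j * (p / k) := by
    obtain ⟨k, hk, rfl⟩ := hdiv r hr (h.mono fun x hx => mem_zmultiples_real.1 hx)
    exact ⟨k, hk, h.mono fun x hx => mem_zmultiples_real.1 hx⟩
  classical
  obtain ⟨hk1, hkG⟩ := Nat.find_spec hex
  have hp0 : 0 < p := hpC.2
  refine ⟨p / Nat.find hex, ⟨div_pos hp0 (by exact_mod_cast hk1), hkG⟩, ?_⟩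
  rintro q ⟨hq, hqG⟩
  obtain ⟨j, hj, rfl⟩ := hdiv q hq hqG
  have : Nat.find hex ≤ j := Nat.find_min' hex ⟨hj, hqG⟩
  gcongr

lemma argValues_of_hasLatticeSpan {γ : ℝ} (hγ : 0 < γ) {G : Measure ℝ} {d : ℝ}
    (h : HasLatticeSpan G d) : argValues γ G = (AddSubgroup.zmultiples d : AddSubgroup ℝ) := by
  ext x
  constructor
  · intro hx
    exact mem_zmultiples_real.2 (hx d hγ h)
  · intro hx d' _ hd'
    rw [hd'.unique h]
    exact mem_zmultiples_real.1 hx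

lemma argValues_eq_univ {γ : ℝ} {G : Measure ℝ} (h : ¬ (0 < γ ∧ ∃ d, HasLatticeSpan G d)) :
    argValues γ G = univ := by
  refine eq_univ_of_forall fun x d hγ hd => absurd ⟨hγ, d, hd⟩ h

/-- The admissible shifts form a subgroup, which is either `ℝ` or a lattice that carries the
distribution. -/
lemma exists_argValues_subgroup (γ : ℝ) (G : Measure ℝ) :
    ∃ V : AddSubgroup ℝ, (V : Set ℝ) = argValues γ G ∧ (∀ᵐ x ∂G, x ∈ V) ∧
      (V = ⊤ ∨ 0 < γ ∧ ∃ d, HasLatticeSpan G d ∧ V = AddSubgroup.zmultiples d) := by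
  by_cases h : 0 < γ ∧ ∃ d, HasLatticeSpan G d
  · obtain ⟨hγ, d, hd⟩ := h
    exact ⟨_, (argValues_of_hasLatticeSpan hγ hd).symm, hd.ae_mem, Or.inr ⟨hγ, d, hd, rfl⟩⟩
  · exact ⟨⊤, by rw [argValues_eq_univ h]; rfl, by simp, Or.inl rfl⟩

/-- If `G` is lattice and in `𝓛(γ)` with `γ > 0`, then every far enough point of the lattice is an
atom, so that `G` is not carried by a coset of a lattice that does not contain the span. -/
lemma ClassL.span_mem_zmultiples {γ : ℝ} (hγ : 0 < γ) {G : Measure ℝ} (hL : ClassL γ G) {d : ℝ}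
    (hd : HasLatticeSpan G d) {c r : ℝ} (h : ∀ᵐ x ∂G, x - c ∈ AddSubgroup.zmultiples r) :
    d ∈ AddSubgroup.zmultiples r := by
  have := hL.dist.prob
  have hV := argValues_of_hasLatticeSpan hγ hd
  have hdV : d ∈ argValues γ G := by rw [hV]; exact AddSubgroup.mem_zmultiples d
  have hd0 := hd.pos
  have hev : ∀ᶠ x in argAtTop γ G, tail G (x - d) / tail G x ≠ 1 := by
    refine (hL.tendsto d hdV).eventually_ne ?_
    rw [Ne, ENNReal.ofReal_eq_one, Real.exp_eq_one_iff]
    positivity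
  rw [argAtTop, eventually_inf_principal, hV] at hev
  have hev2 : ∀ᶠ x in atTop, x ∈ AddSubgroup.zmultiples d → x - c ∈ AddSubgroup.zmultiples r := by
    filter_upwards [hev] with x hx hxV
    have hne : G (Ioc (x - d) x) ≠ 0 := by
      intro h0
      refine hx hxV ?_
      have heq : tail G (x - d) = tail G x := by
        refine le_antisymm ?_ (tail_antitone G (by linarith))
        rw [tail, ← Ioc_union_Ioi_eq_Ioi (show x - d ≤ x by linarith)]
        refine (measure_union_le _ _).trans ?_
        rw [h0, zero_add, tail]
      rw [heq, ENNReal.div_self (hL.tail_pos x).ne' (tail_ne_top G x)]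
    obtain ⟨p, ⟨hp1, hp2⟩, hp3, hp4⟩ : ∃ p ∈ Ioc (x - d) x,
        p ∈ AddSubgroup.zmultiples d ∧ p - c ∈ AddSubgroup.zmultiples r :=
      Measure.exists_mem_of_measure_ne_zero_of_ae hne (ae_restrict_of_ae (hd.ae_mem.and h))
    -- `x` is the only point of the lattice in `(x - d, x]`
    obtain ⟨k, hk⟩ := mem_zmultiples_real.1 ((AddSubgroup.zmultiples d).sub_mem hxV hp3)
    have hk0 : k = 0 := by
      have h1 : (k : ℝ) * d < 1 * d := by linarith
      have h2 : (-1 : ℝ) * d < k * d := by linarith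
      have h3 := lt_of_mul_lt_mul_right h1 hd0.le
      have h4 := lt_of_mul_lt_mul_right h2 hd0.le
      have h5 : k < 1 := by exact_mod_cast h3
      have h6 : -1 < k := by exact_mod_cast h4
      omega
    rw [hk0] at hk
    have : x = p := by simpa [sub_eq_zero] using hk
    rwa [this]
  obtain ⟨N, hN⟩ := eventually_atTop.1 hev2
  obtain ⟨k, hk⟩ := exists_nat_ge (N / d)
  rw [div_le_iff₀ hd0] at hk
  have hk1 := hN (k * d) hk (mem_zmultiples_real.2 ⟨k, by simp⟩)
  have hk2 := hN ((k + 1) * d) (by linarith) (mem_zmultiples_real.2 ⟨k + 1, by simp⟩)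
  have := (AddSubgroup.zmultiples r).sub_mem hk2 hk1
  rwa [show (k + 1 : ℝ) * d - c - (k * d - c) = d by ring] at this

/-- A distribution carried by a coset of `dℤ` has constant tail on intervals of length less than
`d` starting at a point of the coset, which contradicts the growth of ratios by the factor
`e^{γt} > 1` if shifts `0 < t < d` are admissible. -/
lemma TailLiminf.false_of_lt_span {γ : ℝ} (hγ : 0 < γ) {F : Measure ℝ} (hF : IsHalfLineDist F)
    (hpos : ∀ x, 0 < tail F x) (hlim : TailLiminf γ F) {V : AddSubgroup ℝ}
    (hV : (V : Set ℝ) = argValues γ F) (hFV : ∀ᵐ x ∂F, x ∈ V) {c d t : ℝ}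
    (hc : ∀ᵐ x ∂F, x - c ∈ AddSubgroup.zmultiples d) (ht : t ∈ V) (ht0 : 0 < t) (htd : t < d) :
    False := by
  have := hF.prob
  have he : 1 < ENNReal.ofReal (Real.exp (γ * t)) := by
    rw [ENNReal.one_lt_ofReal, Real.one_lt_exp_iff]
    positivity
  have hev := eventually_lt_of_lt_liminf
    (he.trans_le (hlim t (by rw [← hV]; exact ht) ht0))
  rw [argAtTop, eventually_inf_principal, ← hV] at hev
  obtain ⟨N, hN⟩ := eventually_atTop.1 hev
  obtain ⟨p, hp1, hp2, hp3⟩ : ∃ p ∈ Ioi N, p ∈ V ∧ p - c ∈ AddSubgroup.zmultiples d :=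
    Measure.exists_mem_of_measure_ne_zero_of_ae (hpos N).ne' (ae_restrict_of_ae (hFV.and hc))
  have hlt := hN (p + t) (by have : N < p := hp1; linarith) (V.add_mem hp2 ht)
  rw [add_sub_cancel_right] at hlt
  have hnull : F (Ioc p (p + t)) = 0 := by
    refine measure_mono_null (fun y hy => ?_) (ae_iff.1 hc)
    intro hy'
    obtain ⟨k, hk⟩ := mem_zmultiples_real.1 ((AddSubgroup.zmultiples d).sub_mem hy' hp3)
    have hd0 : 0 < d := ht0.trans htd
    have h1 : (k : ℝ) * d < 1 * d := by linarith [hy.2]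
    have h2 : (0 : ℝ) * d < k * d := by linarith [hy.1]
    have h3 := lt_of_mul_lt_mul_right h1 hd0.le
    have h4 := lt_of_mul_lt_mul_right h2 hd0.le
    have h5 : k < 1 := by exact_mod_cast h3
    have h6 : 0 < k := by exact_mod_cast h4
    omega
  have heq : tail F p ≤ tail F (p + t) := by
    rw [tail, ← Ioc_union_Ioi_eq_Ioi (show p ≤ p + t by linarith)]
    refine (measure_union_le _ _).trans ?_
    rw [hnull, zero_add, tail]
  exact hlt.not_ge (ENNReal.div_le_of_le_mul (by rwa [one_mul]))

/-- Under the liminf condition, `F` is carried by the lattice that carries `F^{*n}`. -/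
lemma TailLiminf.ae_mem_zmultiples {γ : ℝ} (hγ : 0 < γ) {F : Measure ℝ} (hF : IsHalfLineDist F)
    (hpos : ∀ x, 0 < tail F x) (hlim : TailLiminf γ F) {n : ℕ} (hn : 1 ≤ n) {d : ℝ}
    (hd : HasLatticeSpan (convPow F n) d) : ∀ᵐ x ∂F, x ∈ AddSubgroup.zmultiples d := by
  have := hF.prob
  obtain ⟨c, hc, -⟩ := exists_ae_sub_mem_of_convPow (measurableSet_zmultiples d) hn hd.ae_mem
  obtain ⟨V, hV, hFV, rfl | ⟨-, d', hd', rfl⟩⟩ := exists_argValues_subgroup γ F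
  · exact (hlim.false_of_lt_span hγ hF hpos hV hFV hc (t := d / 2) trivial
      (half_pos hd.pos) (half_lt_self hd.pos)).elim
  · have hle : d' ≤ d := hd.2 ⟨hd'.pos,
      (ae_mem_convPow (measurableSet_zmultiples d') hd'.ae_mem n).mono
        fun x hx => mem_zmultiples_real.1 hx⟩
    rcases hle.eq_or_lt with rfl | hlt
    · exact hFV
    · exact (hlim.false_of_lt_span hγ hF hpos hV hFV hc (AddSubgroup.mem_zmultiples d')
        hd'.pos hlt).elim

/-- The shifts admissible for `F^{*n}` are admissible for `F`. -/
lemma ClassL.argValues_convPow_subset {γ : ℝ} {F : Measure ℝ} (hF : IsHalfLineDist F) {n : ℕ}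
    (hL : ClassL γ (convPow F n)) : argValues γ (convPow F n) ⊆ argValues γ F := by
  have := hF.prob
  intro x hx r hγ hr
  have hG := ae_mem_convPow (measurableSet_zmultiples r) hr.ae_mem n
  obtain ⟨d, hd⟩ := exists_hasLatticeSpan (hL.tail_pos 0) hr.pos hG
  have hdr := hL.span_mem_zmultiples hγ hd (c := 0) (by simpa using hG)
  rw [argValues_of_hasLatticeSpan hγ hd] at hx
  exact mem_zmultiples_real.1 (AddSubgroup.zmultiples_le_of_mem hdr hx)

/-- If `H` is carried by the lattice of `G`, and `G` is carried by a coset of every lattice that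
carries `H`, then the shifts admissible for `H` are admissible for `G`. -/
lemma ClassL.argValues_subset_of_ae_mem {γ : ℝ} {G H : Measure ℝ} (hL : ClassL γ G)
    (h1 : ∀ d, 0 < γ → HasLatticeSpan G d → ∀ᵐ x ∂H, x ∈ AddSubgroup.zmultiples d)
    (h2 : ∀ r, (∀ᵐ x ∂H, x ∈ AddSubgroup.zmultiples r) →
      ∃ c, ∀ᵐ x ∂G, x - c ∈ AddSubgroup.zmultiples r) :
    argValues γ H ⊆ argValues γ G := by
  intro x hx d hγ hd
  refine hx d hγ ⟨⟨hd.pos, (h1 d hγ hd).mono fun y hy => mem_zmultiples_real.1 hy⟩, ?_⟩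
  rintro r ⟨hr, hrH⟩
  obtain ⟨c, hc⟩ := h2 r (hrH.mono fun y hy => mem_zmultiples_real.2 hy)
  obtain ⟨k, hk⟩ := mem_zmultiples_real.1 (hL.span_mem_zmultiples hγ hd hc)
  have hd0 := hd.pos
  have hk0 : (0 : ℝ) < k := by
    by_contra! hc'
    nlinarith
  have hk1 : (1 : ℝ) ≤ k := by exact_mod_cast (by exact_mod_cast hk0 : 0 < k)
  nlinarith

/-- Points `x → ∞` can be moved down to the group of admissible shifts without changing the
tails of distributions carried by that group. -/
lemma exists_retraction {V : AddSubgroup ℝ}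
    (hV : V = ⊤ ∨ ∃ d, 0 < d ∧ V = AddSubgroup.zmultiples d) :
    ∃ r : ℝ → ℝ, Tendsto r atTop (atTop ⊓ 𝓟 (V : Set ℝ)) ∧
      ∀ S : Measure ℝ, (∀ᵐ x ∂S, x ∈ V) → ∀ x, ∀ t ∈ V, tail S (x - t) = tail S (r x - t) := by
  obtain rfl | ⟨d, hd, rfl⟩ := hV
  · exact ⟨id, by simpa using tendsto_id, fun S _ x t _ => rfl⟩
  refine ⟨fun x => ⌊x / d⌋ * d, tendsto_inf.2 ⟨?_, tendsto_principal.2 (.of_forall fun x =>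
    mem_zmultiples_real.2 ⟨_, rfl⟩)⟩, ?_⟩
  · refine tendsto_atTop_mono (f := fun x => x - d) (fun x => ?_)
      (tendsto_atTop_add_const_right _ _ tendsto_id)
    have h1 := (Int.lt_floor_add_one (x / d)).le
    rw [div_le_iff₀ hd] at h1
    linarith
  · intro S hS x t ht
    have hle : (⌊x / d⌋ : ℝ) * d ≤ x := (le_div_iff₀ hd).1 (Int.floor_le (x / d))
    refine le_antisymm (tail_antitone S (by linarith)) ?_
    have hnull : S (Ioc (⌊x / d⌋ * d - t) (x - t)) = 0 := by
      refine measure_mono_null (fun y hy => ?_) (ae_iff.1 hS)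
      intro hyV
      obtain ⟨k, hk⟩ := mem_zmultiples_real.1 ((AddSubgroup.zmultiples d).add_mem hyV ht)
      have h1 : (k : ℝ) * d ≤ x := by linarith [hy.2]
      have h2 : (k : ℝ) ≤ ⌊x / d⌋ := by
        exact_mod_cast Int.le_floor.2 ((le_div_iff₀ hd).2 h1)
      have h3 := mul_le_mul_of_nonneg_right h2 hd.le
      linarith [hy.1]
    rw [tail, ← Ioc_union_Ioi_eq_Ioi
      (show (⌊x / d⌋ : ℝ) * d - t ≤ x - t by linarith)]
    refine (measure_union_le _ _).trans ?_
    rw [hnull, zero_add, tail]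

/-! ### Comparison of shifted tails relative to a regular tail -/

/-- The factor `e^{γt}`, as an extended nonnegative real. -/
noncomputable def expFactor (γ t : ℝ) : ℝ≥0∞ := ENNReal.ofReal (Real.exp (γ * t))

lemma expFactor_ne_top (γ t : ℝ) : expFactor γ t ≠ ∞ := ENNReal.ofReal_ne_top

lemma expFactor_ne_zero (γ t : ℝ) : expFactor γ t ≠ 0 := by
  simp [expFactor, Real.exp_pos]

lemma expFactor_add (γ s t : ℝ) : expFactor γ (s + t) = expFactor γ s * expFactor γ t := by
  rw [expFactor, mul_add, Real.exp_add, ENNReal.ofReal_mul (Real.exp_nonneg _)]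
  rfl

lemma expFactor_mono {γ : ℝ} (hγ : 0 ≤ γ) {s t : ℝ} (h : s ≤ t) :
    expFactor γ s ≤ expFactor γ t := by
  unfold expFactor
  gcongr

lemma one_le_expFactor {γ : ℝ} (hγ : 0 ≤ γ) {t : ℝ} (h : 0 ≤ t) : 1 ≤ expFactor γ t := by
  simpa [expFactor] using mul_nonneg hγ h

@[fun_prop]
lemma continuous_expFactor (γ : ℝ) : Continuous (expFactor γ) := by
  unfold expFactor
  exact ENNReal.continuous_ofReal.comp (by fun_prop)

lemma tendsto_expFactor_mul_tail {γ : ℝ} (hγ : 0 ≤ γ) {G : Measure ℝ} (hG : IsHalfLineDist G)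
    (hm : expMoment γ G < ∞) :
    Tendsto (fun x => expFactor γ x * tail G x) atTop (𝓝 0) := by
  have h1 : Tendsto (fun x => ∫⁻ y, (Ioi x).indicator (fun y => expFactor γ y) y ∂G) atTop
      (𝓝 (∫⁻ _, 0 ∂G)) := by
    refine tendsto_lintegral_filter_of_dominated_convergence (expFactor γ)
      (.of_forall fun x => Measurable.indicator (by fun_prop) measurableSet_Ioi)
      (.of_forall fun x => .of_forall fun y => indicator_le_self _ _ _) ?_ (.of_forall fun y => ?_)
    · rw [expMoment_eq γ hG] at hm
      exact hm.ne
    · refine tendsto_const_nhds.congr' ?_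
      filter_upwards [eventually_ge_atTop y] with x hx
      rw [indicator_of_notMem (by simpa using hx)]
  rw [lintegral_zero] at h1
  refine tendsto_of_tendsto_of_tendsto_of_le_of_le tendsto_const_nhds h1 (fun _ => zero_le)
    fun x => ?_
  dsimp only
  rw [lintegral_indicator measurableSet_Ioi]
  exact exp_mul_tail_le γ hγ x

/-- A half-line distribution `G` with positive tail and `Ḡ(x - t) ∼ e^{γt} Ḡ(x)` as `x → ∞` through
all real numbers, for the shifts `t` in a subgroup `V` of `ℝ` that carries `G`. -/
structure RegularTail (γ : ℝ) (V : AddSubgroup ℝ) (G : Measure ℝ) : Prop where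
  index_nonneg : 0 ≤ γ
  dist : IsHalfLineDist G
  tail_pos : ∀ x, 0 < tail G x
  measurableSet : MeasurableSet (V : Set ℝ)
  ae_mem : ∀ᵐ x ∂G, x ∈ V
  exists_pos : ∃ t ∈ V, 0 < t
  tendsto : ∀ t ∈ V, Tendsto (fun x => tail G (x - t) / tail G x) atTop (𝓝 (expFactor γ t))

/-- `S̄(x - t) ≤ e^{γt} S̄(x) + o(Ḡ(x))`. -/
def TailUpper (γ t : ℝ) (G S : Measure ℝ) : Prop :=
  ∀ ε : ℝ≥0∞, ε ≠ 0 → ∀ᶠ x in atTop, tail S (x - t) ≤ expFactor γ t * tail S x + ε * tail G x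

/-- `e^{γt} S̄(x) ≤ S̄(x - t) + o(Ḡ(x))`. -/
def TailLower (γ t : ℝ) (G S : Measure ℝ) : Prop :=
  ∀ ε : ℝ≥0∞, ε ≠ 0 → ∀ᶠ x in atTop, expFactor γ t * tail S x ≤ tail S (x - t) + ε * tail G x

namespace RegularTail

variable {γ : ℝ} {V : AddSubgroup ℝ} {G : Measure ℝ}

lemma div_mul_tail (hG : RegularTail γ V G) (a : ℝ≥0∞) (x : ℝ) :
    a / tail G x * tail G x = a := by
  have := hG.dist.prob
  exact ENNReal.div_mul_cancel (hG.tail_pos x).ne' (tail_ne_top G x)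

lemma upper_self (hG : RegularTail γ V G) {t : ℝ} (ht : t ∈ V) : TailUpper γ t G G := by
  intro ε hε
  filter_upwards [(ENNReal.tendsto_nhds (expFactor_ne_top γ t)).1 (hG.tendsto t ht) ε
    (pos_iff_ne_zero.2 hε)] with x hx
  rw [← add_mul, ← hG.div_mul_tail (tail G (x - t)) x]
  gcongr
  exact hx.2

lemma lower_self (hG : RegularTail γ V G) {t : ℝ} (ht : t ∈ V) : TailLower γ t G G := by
  intro ε hε
  filter_upwards [(ENNReal.tendsto_nhds (expFactor_ne_top γ t)).1 (hG.tendsto t ht) ε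
    (pos_iff_ne_zero.2 hε)] with x hx
  rw [← hG.div_mul_tail (tail G (x - t)) x, ← add_mul]
  gcongr
  exact tsub_le_iff_right.1 hx.1

lemma exists_mem_ge (hG : RegularTail γ V G) (a : ℝ) : ∃ t ∈ V, a ≤ t := by
  obtain ⟨t, ht, ht0⟩ := hG.exists_pos
  obtain ⟨N, hN⟩ := exists_nat_ge (a / t)
  exact ⟨N • t, V.nsmul_mem ht N, by rwa [nsmul_eq_mul, ← div_le_iff₀ ht0]⟩

lemma exists_shift_bound (hG : RegularTail γ V G) (a : ℝ) :
    ∃ C : ℝ≥0∞, C ≠ ∞ ∧ ∀ᶠ x in atTop, tail G (x - a) ≤ C * tail G x := by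
  obtain ⟨t, ht, hat⟩ := hG.exists_mem_ge a
  refine ⟨expFactor γ t + 1, by simp [expFactor_ne_top], ?_⟩
  filter_upwards [hG.upper_self ht 1 one_ne_zero] with x hx
  rw [add_mul]
  exact (tail_antitone G (by linarith)).trans hx

/-- The index of a regular tail is its critical exponent: otherwise `e^{(γ+s)x} Ḡ(x) → 0`, while this
function is eventually nondecreasing along shifts. -/
lemma expMoment_eq_top (hG : RegularTail γ V G) {s : ℝ} (hs : 0 < s) :
    expMoment (γ + s) G = ∞ := by
  by_contra hne
  obtain ⟨t, ht, ht0⟩ := hG.exists_pos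
  have hγs : 0 ≤ γ + s := add_nonneg hG.index_nonneg hs.le
  have hlim := tendsto_expFactor_mul_tail hγs hG.dist (lt_top_iff_ne_top.2 hne)
  have hlt : expFactor γ t < expFactor (γ + s) t := by
    rw [expFactor, expFactor, ENNReal.ofReal_lt_ofReal_iff (Real.exp_pos _), Real.exp_lt_exp]
    nlinarith
  obtain ⟨N, hN⟩ := eventually_atTop.1 ((hG.tendsto t ht).eventually (gt_mem_nhds hlt))
  have hmono : ∀ k : ℕ, expFactor (γ + s) N * tail G N ≤
      expFactor (γ + s) (N + k * t) * tail G (N + k * t) := by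
    intro k
    induction k with
    | zero => simp
    | succ k ih =>
      refine ih.trans ?_
      have h1 : N ≤ N + (k + 1 : ℕ) * t := by
        have : (0 : ℝ) ≤ (k + 1 : ℕ) * t := by positivity
        linarith
      have h2 := hN _ h1
      rw [show N + (k + 1 : ℕ) * t - t = N + k * t by push_cast; ring] at h2
      calc expFactor (γ + s) (N + k * t) * tail G (N + k * t)
          = expFactor (γ + s) (N + k * t) * (tail G (N + k * t) /
              tail G (N + (k + 1 : ℕ) * t) * tail G (N + (k + 1 : ℕ) * t)) := by
            rw [hG.div_mul_tail]
        _ ≤ expFactor (γ + s) (N + k * t) * (expFactor (γ + s) t *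
              tail G (N + (k + 1 : ℕ) * t)) := by gcongr
        _ = _ := by
            rw [← mul_assoc, ← expFactor_add]
            congr 2
            push_cast
            ring
  have hseq : Tendsto (fun k : ℕ => N + k * t) atTop atTop :=
    tendsto_atTop_add_const_left _ _ (tendsto_natCast_atTop_atTop.atTop_mul_const ht0)
  have h0 := ge_of_tendsto' (hlim.comp hseq) hmono
  exact (mul_ne_zero (expFactor_ne_zero _ _) (hG.tail_pos N).ne') (le_antisymm h0 zero_le)

/-- Finiteness of the exponential moment makes the event that both summands are large negligible:
`Ḡ(x - A) Ḡ(A - t) ≈ e^{γA} Ḡ(A - t) Ḡ(x)`. -/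
lemma exists_cross_term_le (hG : RegularTail γ V G) (hm : expMoment γ G < ∞) (t a₀ : ℝ)
    {ε : ℝ≥0∞} (hε : ε ≠ 0) :
    ∃ A ∈ V, a₀ ≤ A ∧ ∀ᶠ x in atTop, tail G (x - A) * tail G (A - t) ≤ ε * tail G x := by
  have h1 : Tendsto (fun A => 2 * expFactor γ t * (expFactor γ (A - t) * tail G (A - t))) atTop
      (𝓝 0) := by
    have h2 := ((tendsto_expFactor_mul_tail hG.index_nonneg hG.dist hm).comp
      (tendsto_atTop_add_const_right atTop (-t) tendsto_id))
    have h3 := ENNReal.Tendsto.const_mul (a := 2 * expFactor γ t) h2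
      (Or.inr (ENNReal.mul_ne_top (by simp) (expFactor_ne_top γ t)))
    simpa [Function.comp_def, ← sub_eq_add_neg] using h3
  obtain ⟨N, hN⟩ := eventually_atTop.1 (h1.eventually (ge_mem_nhds (pos_iff_ne_zero.2 hε)))
  obtain ⟨A, hA, hNA⟩ := hG.exists_mem_ge (max N (max a₀ 0))
  have hA0 : 0 ≤ A := ((le_max_right _ _).trans (le_max_right _ _)).trans hNA
  refine ⟨A, hA, ((le_max_left _ _).trans (le_max_right _ _)).trans hNA, ?_⟩
  filter_upwards [hG.upper_self hA 1 one_ne_zero] with x hx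
  have h4 : tail G (x - A) ≤ 2 * expFactor γ A * tail G x := by
    refine hx.trans ?_
    rw [two_mul, add_mul]
    gcongr
    exact one_le_expFactor hG.index_nonneg hA0
  calc tail G (x - A) * tail G (A - t) ≤ 2 * expFactor γ A * tail G x * tail G (A - t) := by gcongr
    _ = 2 * expFactor γ t * (expFactor γ (A - t) * tail G (A - t)) * tail G x := by
      rw [show expFactor γ A = expFactor γ t * expFactor γ (A - t) by
        rw [← expFactor_add]; congr 1; ring]
      ring
    _ ≤ ε * tail G x := by
      gcongr
      exact hN A ((le_max_left _ _).trans hNA)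

/-- An upper comparison of shifted tails is preserved by convolution. -/
lemma upper_conv (hG : RegularTail γ V G) (hm : expMoment γ G < ∞) {K : ℝ≥0∞} (hK : K ≠ ∞)
    (hG2 : ∀ x, tail (G.conv G) x ≤ K * tail G x) {S T : Measure ℝ} [IsProbabilityMeasure S]
    [IsProbabilityMeasure T] {C D : ℝ≥0∞} (hC : C ≠ ∞) (hD : D ≠ ∞)
    (hS : ∀ x, tail S x ≤ C * tail G x) (hT : ∀ x, tail T x ≤ D * tail G x) {t : ℝ} (ht : 0 ≤ t)
    (hSu : TailUpper γ t G S) (hTu : TailUpper γ t G T) : TailUpper γ t G (S.conv T) := by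
  have := hG.dist.prob
  intro ε hε
  set M : ℝ≥0∞ := D * K + C * K + D * C + 1 with hM
  have hMtop : M ≠ ∞ := by finiteness
  have hM0 : M ≠ 0 := by simp [hM]
  set η := ε / M with hη
  have hη0 : η ≠ 0 := (ENNReal.div_pos hε hMtop).ne'
  obtain ⟨a₀, ha₀⟩ := eventually_atTop.1 (hSu η hη0)
  obtain ⟨b₀, hb₀⟩ := eventually_atTop.1 (hTu η hη0)
  obtain ⟨A, -, hA, hcross⟩ := hG.exists_cross_term_le hm t a₀ hη0
  filter_upwards [hcross, eventually_ge_atTop (b₀ + A)] with x hx hxb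
  rw [tail_conv_split S T (A - t) (x - t), tail_conv_split S T A x,
    show x - t - (A - t) = x - A by ring]
  have hI : ∫⁻ y in Iic (x - A), tail S (x - t - y) ∂T ≤
      expFactor γ t * ∫⁻ y in Iic (x - A), tail S (x - y) ∂T + η * (D * K * tail G x) := by
    calc _ ≤ ∫⁻ y in Iic (x - A),
          (expFactor γ t * tail S (x - y) + η * tail G (x - y)) ∂T := by
          refine setLIntegral_mono' measurableSet_Iic fun y hy => ?_
          have hy' : y ≤ x - A := hy
          rw [show x - t - y = x - y - t by ring]
          exact ha₀ _ (by linarith)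
      _ = expFactor γ t * ∫⁻ y in Iic (x - A), tail S (x - y) ∂T +
          η * ∫⁻ y in Iic (x - A), tail G (x - y) ∂T := by
          rw [lintegral_add_left (by fun_prop), lintegral_const_mul _ (by fun_prop),
            lintegral_const_mul _ (by fun_prop)]
      _ ≤ _ := by
          gcongr
          calc _ ≤ tail (G.conv T) x := setLIntegral_tail_le_tail_conv G T x _
            _ = tail (T.conv G) x := by rw [Measure.conv_comm]
            _ ≤ D * tail (G.conv G) x := tail_conv_le_mul G hT x
            _ ≤ D * K * tail G x := by rw [mul_assoc]; gcongr; exact hG2 x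
  have hJ : ∫⁻ s, tail T (x - t - min s (A - t)) ∂S ≤
      expFactor γ t * ∫⁻ s, tail T (x - min s A) ∂S + η * (C * K * tail G x)
        + η * (D * C * tail G x) := by
    calc _ ≤ ∫⁻ s, (expFactor γ t * tail T (x - min s A) + η * tail G (x - s)
          + (Ioi (A - t)).indicator (fun _ => tail T (x - A)) s) ∂S := by
          refine lintegral_mono fun s => ?_
          rcases le_or_gt s (A - t) with hs | hs
          · rw [min_eq_left hs, min_eq_left (by linarith), show x - t - s = x - s - t by ring]
            exact (hb₀ _ (by linarith)).trans le_self_add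
          · rw [min_eq_right hs.le, indicator_of_mem (by exact hs),
              show x - t - (A - t) = x - A by ring]
            exact le_add_self
      _ = expFactor γ t * ∫⁻ s, tail T (x - min s A) ∂S + η * tail (G.conv S) x
          + tail T (x - A) * tail S (A - t) := by
          rw [lintegral_add_left (by fun_prop), lintegral_add_left (by fun_prop),
            lintegral_const_mul _ (by fun_prop), lintegral_const_mul _ (by fun_prop),
            lintegral_indicator_const measurableSet_Ioi, tail_conv]
          rfl
      _ ≤ _ := by
          refine add_le_add (add_le_add le_rfl ?_) ?_
          · gcongr
            calc _ = tail (S.conv G) x := by rw [Measure.conv_comm]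
              _ ≤ C * tail (G.conv G) x := tail_conv_le_mul G hS x
              _ ≤ C * K * tail G x := by rw [mul_assoc]; gcongr; exact hG2 x
          · calc _ ≤ D * tail G (x - A) * (C * tail G (A - t)) := mul_le_mul' (hT _) (hS _)
              _ = D * C * (tail G (x - A) * tail G (A - t)) := by ring
              _ ≤ D * C * (η * tail G x) := by gcongr
              _ = _ := by ring
  calc _ ≤ _ := add_le_add hI hJ
    _ = expFactor γ t * (∫⁻ y in Iic (x - A), tail S (x - y) ∂T + ∫⁻ s, tail T (x - min s A) ∂S)
        + η * (D * K + C * K + D * C) * tail G x := by ring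
    _ ≤ _ := by
      gcongr
      calc η * (D * K + C * K + D * C) ≤ η * M := by gcongr; exact le_self_add
        _ = ε := ENNReal.div_mul_cancel hM0 hMtop

/-- A lower comparison of shifted tails is preserved by convolution. If moreover the comparison for
`S` with the shift `t` has a defect at the point `x - a - h`, then the comparison for the
convolution with the shift `t + h` gains this defect times the mass that `T` gives to
`[a, a + h]`. -/
lemma lower_conv_add_defect (hG : RegularTail γ V G) (hm : expMoment γ G < ∞) {K : ℝ≥0∞}
    (hK : K ≠ ∞) (hG2 : ∀ x, tail (G.conv G) x ≤ K * tail G x) {S T : Measure ℝ}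
    [IsProbabilityMeasure S] [IsProbabilityMeasure T] {C D : ℝ≥0∞} (hC : C ≠ ∞) (hD : D ≠ ∞)
    (hS : ∀ x, tail S x ≤ C * tail G x) (hT : ∀ x, tail T x ≤ D * tail G x) {t a h : ℝ}
    (ht : 0 ≤ t) (hh : 0 ≤ h)
    (hSl : TailLower γ (t + h) G S) (hTl : TailLower γ (t + h) G T) {ε : ℝ≥0∞} (hε : ε ≠ 0) :
    ∀ᶠ x in atTop, expFactor γ (t + h) * tail (S.conv T) x +
        (tail S (x - a - h - t) - expFactor γ (t + h) * tail S (x - a - h)) * T (Icc a (a + h)) ≤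
      tail (S.conv T) (x - (t + h)) + ε * tail G x := by
  have := hG.dist.prob
  set u := t + h with hu
  have hu0 : 0 ≤ u := by positivity
  set M : ℝ≥0∞ := D * K + C * K + expFactor γ u * D * C + 1 with hM
  have hMtop : M ≠ ∞ := by have := expFactor_ne_top γ u; finiteness
  have hM0 : M ≠ 0 := by simp [hM]
  set η := ε / M with hη
  have hη0 : η ≠ 0 := (ENNReal.div_pos hε hMtop).ne'
  obtain ⟨a₀, ha₀⟩ := eventually_atTop.1 (hSl η hη0)
  obtain ⟨b₀, hb₀⟩ := eventually_atTop.1 (hTl η hη0)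
  obtain ⟨A, -, hA, hcross⟩ := hG.exists_cross_term_le hm u a₀ hη0
  filter_upwards [hcross, eventually_ge_atTop (b₀ + A), eventually_ge_atTop (a + h + A)]
    with x hx hxb hxa
  set Δ := tail S (x - a - h - t) - expFactor γ u * tail S (x - a - h) with hΔ
  rw [tail_conv_split S T (A - u) (x - u), tail_conv_split S T A x,
    show x - u - (A - u) = x - A by ring]
  have hI : expFactor γ u * ∫⁻ y in Iic (x - A), tail S (x - y) ∂T + Δ * T (Icc a (a + h)) ≤
      ∫⁻ y in Iic (x - A), tail S (x - u - y) ∂T + η * (D * K * tail G x) := by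
    calc _ = ∫⁻ y in Iic (x - A), (expFactor γ u * tail S (x - y)
            + (Icc a (a + h)).indicator (fun _ => Δ) y) ∂T := by
          rw [lintegral_add_left (by fun_prop), lintegral_const_mul _ (by fun_prop),
            lintegral_indicator_const measurableSet_Icc, Measure.restrict_apply measurableSet_Icc,
            inter_eq_self_of_subset_left]
          exact fun y hy => hy.2.trans (by linarith)
      _ ≤ ∫⁻ y in Iic (x - A), (tail S (x - u - y) + η * tail G (x - y)) ∂T := by
          refine setLIntegral_mono' measurableSet_Iic fun y hy => ?_
          have hy' : y ≤ x - A := hy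
          have hlow : expFactor γ u * tail S (x - y) ≤ tail S (x - u - y) + η * tail G (x - y) := by
            rw [show x - u - y = x - y - u by ring]
            exact ha₀ _ (by linarith)
          by_cases hya : y ∈ Icc a (a + h)
          · rw [indicator_of_mem hya]
            rcases le_total (tail S (x - a - h - t)) (expFactor γ u * tail S (x - a - h))
              with hle | hle
            · rw [hΔ, tsub_eq_zero_of_le hle, add_zero]
              exact hlow
            · calc expFactor γ u * tail S (x - y) + Δ
                  ≤ expFactor γ u * tail S (x - a - h) + Δ := by
                    gcongr
                    exact tail_antitone S (by linarith [hya.2])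
                _ = tail S (x - a - h - t) := add_tsub_cancel_of_le hle
                _ ≤ tail S (x - u - y) := tail_antitone S (by linarith [hya.1])
                _ ≤ _ := le_self_add
          · rw [indicator_of_notMem hya, add_zero]
            exact hlow
      _ = ∫⁻ y in Iic (x - A), tail S (x - u - y) ∂T +
          η * ∫⁻ y in Iic (x - A), tail G (x - y) ∂T := by
          rw [lintegral_add_left (by fun_prop), lintegral_const_mul _ (by fun_prop)]
      _ ≤ _ := by
          gcongr
          calc _ ≤ tail (G.conv T) x := setLIntegral_tail_le_tail_conv G T x _
            _ = tail (T.conv G) x := by rw [Measure.conv_comm]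
            _ ≤ D * tail (G.conv G) x := tail_conv_le_mul G hT x
            _ ≤ D * K * tail G x := by rw [mul_assoc]; gcongr; exact hG2 x
  have hJ : expFactor γ u * ∫⁻ s, tail T (x - min s A) ∂S ≤
      ∫⁻ s, tail T (x - u - min s (A - u)) ∂S + η * (C * K * tail G x)
        + η * (expFactor γ u * D * C * tail G x) := by
    calc _ = ∫⁻ s, expFactor γ u * tail T (x - min s A) ∂S := by
          rw [lintegral_const_mul _ (by fun_prop)]
      _ ≤ ∫⁻ s, (tail T (x - u - min s (A - u)) + η * tail G (x - s)
          + (Ioi (A - u)).indicator (fun _ => expFactor γ u * tail T (x - A)) s) ∂S := by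
          refine lintegral_mono fun s => ?_
          rcases le_or_gt s (A - u) with hs | hs
          · rw [min_eq_left hs, min_eq_left (by linarith), show x - u - s = x - s - u by ring]
            exact (hb₀ _ (by linarith)).trans le_self_add
          · rw [indicator_of_mem (by exact hs)]
            refine le_trans ?_ le_add_self
            gcongr
            exact tail_antitone T (by linarith [min_le_right s A])
      _ = ∫⁻ s, tail T (x - u - min s (A - u)) ∂S + η * tail (G.conv S) x
          + expFactor γ u * tail T (x - A) * tail S (A - u) := by
          rw [lintegral_add_left (by fun_prop), lintegral_add_left (by fun_prop),
            lintegral_const_mul _ (by fun_prop),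
            lintegral_indicator_const measurableSet_Ioi, tail_conv]
          rfl
      _ ≤ _ := by
          refine add_le_add (add_le_add le_rfl ?_) ?_
          · gcongr
            calc _ = tail (S.conv G) x := by rw [Measure.conv_comm]
              _ ≤ C * tail (G.conv G) x := tail_conv_le_mul G hS x
              _ ≤ C * K * tail G x := by rw [mul_assoc]; gcongr; exact hG2 x
          · calc _ ≤ expFactor γ u * (D * tail G (x - A)) * (C * tail G (A - u)) :=
                  mul_le_mul' (mul_le_mul' le_rfl (hT _)) (hS _)
              _ = expFactor γ u * D * C * (tail G (x - A) * tail G (A - u)) := by ring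
              _ ≤ expFactor γ u * D * C * (η * tail G x) := by gcongr
              _ = _ := by ring
  calc _ = (expFactor γ u * ∫⁻ y in Iic (x - A), tail S (x - y) ∂T + Δ * T (Icc a (a + h)))
        + expFactor γ u * ∫⁻ s, tail T (x - min s A) ∂S := by ring
    _ ≤ _ := add_le_add hI hJ
    _ = (∫⁻ y in Iic (x - A), tail S (x - u - y) ∂T + ∫⁻ s, tail T (x - u - min s (A - u)) ∂S)
        + η * (D * K + C * K + expFactor γ u * D * C) * tail G x := by ring
    _ ≤ _ := by
      gcongr
      calc η * (D * K + C * K + expFactor γ u * D * C) ≤ η * M := by gcongr; exact le_self_add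
        _ = ε := ENNReal.div_mul_cancel hM0 hMtop

lemma lower_conv (hG : RegularTail γ V G) (hm : expMoment γ G < ∞) {K : ℝ≥0∞} (hK : K ≠ ∞)
    (hG2 : ∀ x, tail (G.conv G) x ≤ K * tail G x) {S T : Measure ℝ} [IsProbabilityMeasure S]
    [IsProbabilityMeasure T] {C D : ℝ≥0∞} (hC : C ≠ ∞) (hD : D ≠ ∞)
    (hS : ∀ x, tail S x ≤ C * tail G x) (hT : ∀ x, tail T x ≤ D * tail G x) {t : ℝ} (ht : 0 ≤ t)
    (hSl : TailLower γ t G S) (hTl : TailLower γ t G T) : TailLower γ t G (S.conv T) := by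
  intro ε hε
  have h := hG.lower_conv_add_defect hm hK hG2 hC hD hS hT (a := 0) ht le_rfl
    (by simpa using hSl) (by simpa using hTl) hε
  simp only [add_zero] at h
  exact h.mono fun x hx => le_self_add.trans hx

/-- If `G = S ∗ T` and both factors satisfy the lower comparison, then the factor `S` satisfies the
upper comparison as well: a defect of `S` would show up in `G`. -/
lemma upper_of_conv_eq (hG : RegularTail γ V G) (hm : expMoment γ G < ∞) {K : ℝ≥0∞} (hK : K ≠ ∞)
    (hG2 : ∀ x, tail (G.conv G) x ≤ K * tail G x) {S T : Measure ℝ} (hS : IsHalfLineDist S)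
    (hT : IsHalfLineDist T) (hST : S.conv T = G)
    (hSl : ∀ t ∈ V, 0 < t → TailLower γ t G S) (hTl : ∀ t ∈ V, 0 < t → TailLower γ t G T)
    (hmass : ∀ η : ℝ, 0 < η → ∃ h ∈ V, 0 ≤ h ∧ h < η ∧ ∃ a, 0 ≤ a ∧ T (Icc a (a + h)) ≠ 0)
    {t : ℝ} (htV : t ∈ V) (ht : 0 < t) : TailUpper γ t G S := by
  have := hG.dist.prob
  have := hS.prob
  have := hT.prob
  intro ε hε
  have hcont : ContinuousAt (fun h => expFactor γ (t + h)) 0 :=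
    Continuous.continuousAt (by fun_prop)
  have hev : ∀ᶠ h in 𝓝 (0 : ℝ), expFactor γ (t + h) < expFactor γ t + ε / 2 := by
    refine hcont.eventually (gt_mem_nhds ?_)
    simp only [add_zero]
    exact ENNReal.lt_add_right (expFactor_ne_top γ t) (by simpa using hε)
  obtain ⟨r, hr, hball⟩ := Metric.eventually_nhds_iff.1 hev
  obtain ⟨h, hhV, hh0, hhr, a, ha, hq⟩ := hmass r hr
  have hexp : expFactor γ (t + h) ≤ expFactor γ t + ε / 2 :=
    (hball (by simpa [abs_of_nonneg hh0] using hhr)).le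
  set q := T (Icc a (a + h)) with hqdef
  have hqtop : q ≠ ∞ := measure_ne_top _ _
  have huV : t + h ∈ V := V.add_mem htV hhV
  have hδ : ε / 2 * q / 2 ≠ 0 := by simp [hε, hq]
  have hSle : ∀ x, tail S x ≤ 1 * tail G x := fun x => by
    rw [one_mul, ← hST]; exact tail_le_tail_conv hT x
  have hTle : ∀ x, tail T x ≤ 1 * tail G x := fun x => by
    rw [one_mul, ← hST, Measure.conv_comm]; exact tail_le_tail_conv hS x
  have h1 := hG.lower_conv_add_defect hm hK hG2 ENNReal.one_ne_top ENNReal.one_ne_top hSle hTle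
    (a := a) ht.le hh0 (hSl _ huV (by positivity)) (hTl _ huV (by positivity)) hδ
  have h2 := hG.upper_self huV _ hδ
  rw [hST] at h1
  have h3 : Tendsto (fun w : ℝ => w + (a + h)) atTop atTop :=
    tendsto_atTop_add_const_right _ _ tendsto_id
  filter_upwards [h3.eventually h1, h3.eventually h2] with w hw1 hw2
  rw [show w + (a + h) - a - h = w by ring] at hw1
  set Δ := tail S (w - t) - expFactor γ (t + h) * tail S w with hΔ
  have hle : expFactor γ (t + h) * tail G (w + (a + h)) + Δ * q ≤
      expFactor γ (t + h) * tail G (w + (a + h)) + ε / 2 * tail G w * q := by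
    calc _ ≤ _ := hw1
      _ ≤ _ := add_le_add_left hw2 _
      _ = expFactor γ (t + h) * tail G (w + (a + h)) +
          (ε / 2 * q / 2 + ε / 2 * q / 2) * tail G (w + (a + h)) := by ring
      _ ≤ _ := by
        rw [ENNReal.add_halves, mul_right_comm (ε / 2)]
        gcongr
        exact tail_antitone G (by linarith)
  have hΔle : Δ ≤ ε / 2 * tail G w :=
    (ENNReal.mul_le_mul_iff_left hq hqtop).1
      ((ENNReal.add_le_add_iff_left (ENNReal.mul_ne_top (expFactor_ne_top _ _)
        (tail_ne_top _ _))).1 hle)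
  calc tail S (w - t) ≤ Δ + expFactor γ (t + h) * tail S w := le_tsub_add
    _ ≤ ε / 2 * tail G w + (expFactor γ t + ε / 2) * tail S w := by gcongr
    _ = expFactor γ t * tail S w + (ε / 2 * tail G w + ε / 2 * tail S w) := by ring
    _ ≤ expFactor γ t * tail S w + (ε / 2 * tail G w + ε / 2 * tail G w) := by
      gcongr
      simpa using hSle w
    _ = expFactor γ t * tail S w + ε * tail G w := by rw [← add_mul, ENNReal.add_halves]

end RegularTail

/-! ### Asymptotic bounds for the convolution powers of a regular tail -/

namespace RegularTail

variable {γ : ℝ} {V : AddSubgroup ℝ} {G : Measure ℝ}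

lemma tendsto_lintegral_tail_sub_min_div (hG : RegularTail γ V G) {S : Measure ℝ}
    [IsProbabilityMeasure S] (hSV : ∀ᵐ s ∂S, s ∈ V) {A : ℝ} (hA : A ∈ V) :
    Tendsto (fun x => (∫⁻ s, tail G (x - min s A) ∂S) / tail G x) atTop
      (𝓝 (∫⁻ s, expFactor γ (min s A) ∂S)) := by
  obtain ⟨C, hC, hCb⟩ := hG.exists_shift_bound A
  have heq : ∀ x, (∫⁻ s, tail G (x - min s A) ∂S) / tail G x =
      ∫⁻ s, tail G (x - min s A) / tail G x ∂S := by
    intro x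
    simp only [div_eq_mul_inv]
    rw [lintegral_mul_const _ (by fun_prop)]
  simp only [heq]
  refine tendsto_lintegral_filter_of_dominated_convergence (fun _ => C)
    (.of_forall fun x => by fun_prop) ?_ (by simpa using hC) ?_
  · filter_upwards [hCb] with x hx
    refine .of_forall fun s => ENNReal.div_le_of_le_mul ?_
    exact (tail_antitone G (by linarith [min_le_right s A])).trans hx
  · filter_upwards [hSV] with s hs
    refine hG.tendsto _ ?_
    rcases le_total s A with h | h <;> simp [h, hs, hA]

lemma lintegral_expFactor_min_le (hG : RegularTail γ V G) {S : Measure ℝ} (hS : IsHalfLineDist S)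
    (A : ℝ) : ∫⁻ s, expFactor γ (min s A) ∂S ≤ expMoment γ S := by
  rw [expMoment_eq γ hS]
  exact lintegral_mono fun s => expFactor_mono hG.index_nonneg (min_le_left _ _)

lemma tendsto_lintegral_expFactor_min (hG : RegularTail γ V G) {t : ℝ} (ht : 0 < t) :
    Tendsto (fun N : ℕ => ∫⁻ s, expFactor γ (min s (N • t)) ∂G) atTop
      (𝓝 (expMoment γ G)) := by
  rw [expMoment_eq γ hG.dist]
  refine lintegral_tendsto_of_tendsto_of_monotone (fun N => by fun_prop) ?_ ?_
  · refine .of_forall fun s N M hNM => expFactor_mono hG.index_nonneg ?_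
    gcongr
  · refine .of_forall fun s => tendsto_const_nhds.congr' ?_
    have h1 : Tendsto (fun N : ℕ => N • t) atTop atTop :=
      tendsto_id.atTop_nsmul_const ht
    filter_upwards [h1.eventually_ge_atTop s] with N hN
    rw [min_eq_left hN]
    rfl

/-- In `G ∗ G`, the event that the second summand exceeds `x - A` contributes asymptotically the
truncated exponential moment times `Ḡ(x)`; the complementary event contains the one that the first
summand exceeds `x`, of probability `(1 - o(1)) Ḡ(x)`. -/
lemma expMoment_add_one_le_cStar (hG : RegularTail γ V G) : expMoment γ G + 1 ≤ cStar G := by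
  have := hG.dist.prob
  obtain ⟨t, ht, ht0⟩ := hG.exists_pos
  refine le_of_tendsto' ((hG.tendsto_lintegral_expFactor_min ht0).add_const 1) fun N => ?_
  have hA : N • t ∈ V := V.nsmul_mem ht N
  have h1 := hG.tendsto_lintegral_tail_sub_min_div hG.ae_mem hA
  have h2 : Tendsto (fun x => G (Iic (x - N • t))) atTop (𝓝 1) := by
    rw [← measure_univ (μ := G)]
    exact (tendsto_measure_Iic_atTop G).comp
      (tendsto_atTop_add_const_right _ (-(N • t)) tendsto_id)
  rw [← (h1.add h2).limsup_eq, cStar]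
  refine limsup_le_limsup (.of_forall fun x => ?_)
  dsimp only
  rw [convPow_two, tail_conv_split G G (N • t) x, add_comm, ENNReal.add_div]
  gcongr
  rw [ENNReal.le_div_iff_mul_le (Or.inl (hG.tail_pos x).ne') (Or.inl (tail_ne_top G x))]
  calc G (Iic (x - N • t)) * tail G x = ∫⁻ _ in Iic (x - N • t), tail G x ∂G := by
        rw [setLIntegral_const, mul_comm]
    _ ≤ _ := lintegral_mono_ae (ae_restrict_of_ae (hG.dist.ae_nonneg.mono fun y hy =>
        tail_antitone G (by linarith)))

/-- The part of the tail of `G ∗ G` on which the second summand is at most `x - A` is asymptotically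
at most `(C*(G) - m(G)) Ḡ`, up to an error that vanishes as `A → ∞`. -/
lemma exists_setLIntegral_tail_le (hG : RegularTail γ V G) (hC : cStar G < ∞) (a₀ : ℝ) {ε : ℝ≥0∞}
    (hε : ε ≠ 0) :
    ∃ A ∈ V, a₀ ≤ A ∧ ∀ᶠ x in atTop,
      ∫⁻ y in Iic (x - A), tail G (x - y) ∂G ≤ (cStar G - expMoment γ G + ε) * tail G x := by
  have := hG.dist.prob
  have hmC := hG.expMoment_add_one_le_cStar
  have hm : expMoment γ G ≠ ∞ := ((le_self_add.trans hmC).trans_lt hC).ne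
  obtain ⟨t, ht, ht0⟩ := hG.exists_pos
  have hδ : ε / 3 ≠ 0 := by simp [hε]
  have h1 : Tendsto (fun N : ℕ => N • t) atTop atTop := tendsto_id.atTop_nsmul_const ht0
  obtain ⟨N, hN1, hN2⟩ := ((h1.eventually_ge_atTop a₀).and
    ((ENNReal.tendsto_nhds hm).1 (hG.tendsto_lintegral_expFactor_min ht0) (ε / 3)
      (pos_iff_ne_zero.2 hδ))).exists
  have hA : N • t ∈ V := V.nsmul_mem ht N
  refine ⟨N • t, hA, hN1, ?_⟩
  have hIfin : ∫⁻ s, expFactor γ (min s (N • t)) ∂G ≠ ∞ :=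
    ne_top_of_le_ne_top hm (hG.lintegral_expFactor_min_le hG.dist _)
  have hJ := (ENNReal.tendsto_nhds hIfin).1 (hG.tendsto_lintegral_tail_sub_min_div hG.ae_mem hA)
    (ε / 3) (pos_iff_ne_zero.2 hδ)
  have hlim : ∀ᶠ x in atTop, tail (convPow G 2) x / tail G x < cStar G + ε / 3 :=
    eventually_lt_of_limsup_lt (ENNReal.lt_add_right hC.ne hδ)
  filter_upwards [hJ, hlim] with x hx1 hx2
  rw [convPow_two, tail_conv_split G G (N • t) x, ENNReal.add_div] at hx2
  set R := ∫⁻ y in Iic (x - N • t), tail G (x - y) ∂G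
  rw [← hG.div_mul_tail R x]
  gcongr
  set J := (∫⁻ s, tail G (x - min s (N • t)) ∂G) / tail G x
  have h3 : expMoment γ G ≤ J + ε / 3 + ε / 3 :=
    (tsub_le_iff_right.1 hN2.1).trans (by gcongr; exact tsub_le_iff_right.1 hx1.1)
  refine (ENNReal.add_le_add_iff_right hm).1 ?_
  calc R / tail G x + expMoment γ G ≤ R / tail G x + (J + ε / 3 + ε / 3) := by gcongr
    _ = R / tail G x + J + (ε / 3 + ε / 3) := by ring
    _ ≤ cStar G + ε / 3 + (ε / 3 + ε / 3) := by gcongr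
    _ = cStar G + ε := by
      rw [add_assoc, ← add_assoc (ε / 3), ENNReal.add_thirds]
    _ = cStar G - expMoment γ G + ε + expMoment γ G := by
      rw [add_right_comm, tsub_add_cancel_of_le (le_self_add.trans hmC)]

/-- `limsup tail (G^{*(k+1)}) / Ḡ ≤ ∑_{i ≤ k} m(G)^i (C*(G) - m(G))^{k-i}`. The recursion behind
this bound is `a_{k+1} = (C* - m) a_k + m^{k+1}`. -/
lemma eventually_tail_convPow_le (hG : RegularTail γ V G) (hC : cStar G < ∞) (k : ℕ) {ε : ℝ≥0∞}
    (hε : ε ≠ 0) :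
    ∀ᶠ x in atTop, tail (convPow G (k + 1)) x ≤
      (∑ i ∈ Finset.range (k + 1),
        expMoment γ G ^ i * (cStar G - expMoment γ G) ^ (k - i) + ε) * tail G x := by
  have := hG.dist.prob
  have hm : expMoment γ G ≠ ∞ :=
    ((le_self_add.trans hG.expMoment_add_one_le_cStar).trans_lt hC).ne
  set m := expMoment γ G with hmdef
  set c := cStar G - m with hc
  have hctop : c ≠ ∞ := ne_top_of_le_ne_top hC.ne tsub_le_self
  induction k generalizing ε with
  | zero =>
    refine .of_forall fun x => ?_
    simp only [zero_add, convPow_one, Finset.range_one, Finset.sum_singleton, Nat.sub_self,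
      pow_zero, mul_one]
    rw [add_mul, one_mul]
    exact le_self_add
  | succ k ih =>
    set a := ∑ i ∈ Finset.range (k + 1), m ^ i * c ^ (k - i) with ha
    have hatop : a ≠ ∞ := by
      refine ENNReal.sum_ne_top.2 fun i _ => ?_
      finiteness
    have hrec : ∑ i ∈ Finset.range (k + 1 + 1), m ^ i * c ^ (k + 1 - i) = a * c + m ^ (k + 1) := by
      rw [Finset.sum_range_succ, Nat.sub_self, pow_zero, mul_one, ha, Finset.sum_mul]
      congr 1
      refine Finset.sum_congr rfl fun i hi => ?_
      rw [mul_assoc, ← pow_succ, Nat.sub_add_comm (Nat.lt_succ_iff.1 (Finset.mem_range.1 hi))]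
    rw [hrec]
    set M := a + c + 2 with hM
    have hMtop : M ≠ ∞ := by finiteness
    have hM0 : M ≠ 0 := by simp [hM]
    set δ := min 1 (ε / M) with hδ
    have hδ0 : δ ≠ 0 := (lt_min one_pos (ENNReal.div_pos hε hMtop)).ne'
    have hδM : δ * M ≤ ε :=
      (mul_le_mul' (min_le_right _ _) le_rfl).trans (ENNReal.div_mul_cancel hM0 hMtop).le
    obtain ⟨a₀, ha₀⟩ := eventually_atTop.1 (ih hδ0)
    obtain ⟨A, hA, haA, hR⟩ := hG.exists_setLIntegral_tail_le hC a₀ hδ0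
    have hP := isHalfLineDist_convPow hG.dist (k + 1)
    have hIle : ∫⁻ s, expFactor γ (min s A) ∂(convPow G (k + 1)) ≤ m ^ (k + 1) := by
      rw [hmdef, ← expMoment_convPow γ hG.dist]
      exact hG.lintegral_expFactor_min_le hP A
    have hJ := (ENNReal.tendsto_nhds (ne_top_of_le_ne_top (ENNReal.pow_ne_top hm) hIle)).1
      (hG.tendsto_lintegral_tail_sub_min_div
        (ae_mem_convPow hG.measurableSet hG.ae_mem (k + 1)) hA) δ (pos_iff_ne_zero.2 hδ0)
    filter_upwards [hR, hJ] with x hxR hxJ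
    rw [convPow, tail_conv_split _ G A x]
    have h1 : ∫⁻ y in Iic (x - A), tail (convPow G (k + 1)) (x - y) ∂G ≤
        (a + δ) * ((c + δ) * tail G x) := by
      calc _ ≤ ∫⁻ y in Iic (x - A), (a + δ) * tail G (x - y) ∂G := by
            refine setLIntegral_mono' measurableSet_Iic fun y hy => ha₀ _ ?_
            have hy' : y ≤ x - A := hy
            linarith
        _ = (a + δ) * ∫⁻ y in Iic (x - A), tail G (x - y) ∂G := by
            rw [lintegral_const_mul _ (by fun_prop)]
        _ ≤ _ := by gcongr
    have h2 : ∫⁻ s, tail G (x - min s A) ∂(convPow G (k + 1)) ≤ (m ^ (k + 1) + δ) * tail G x := by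
      rw [← hG.div_mul_tail (∫⁻ s, tail G (x - min s A) ∂(convPow G (k + 1))) x]
      gcongr
      exact hxJ.2.trans (by gcongr)
    calc _ ≤ _ := add_le_add h1 h2
      _ = (a * c + m ^ (k + 1) + (δ * a + δ * c + δ * δ + δ)) * tail G x := by ring
      _ ≤ _ := by
        gcongr
        calc δ * a + δ * c + δ * δ + δ ≤ δ * a + δ * c + δ * 1 + δ := by
              gcongr
              exact min_le_left _ _
          _ = δ * M := by rw [hM]; ring
          _ ≤ ε := hδM

/-- A Kesten-type bound: the tails of the convolution powers grow at most geometrically, uniformly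
on the line, with any ratio above `C*(G) - m(G)`. -/
lemma exists_kesten_bound (hG : RegularTail γ V G) (hC : cStar G < ∞) {ε : ℝ≥0∞} (hε : ε ≠ 0) :
    ∃ K : ℝ≥0∞, K ≠ ∞ ∧ ∀ k x,
      tail (convPow G (k + 1)) x ≤ K * (cStar G - expMoment γ G + ε) ^ (k + 1) * tail G x := by
  have := hG.dist.prob
  have hmC := hG.expMoment_add_one_le_cStar
  have hm : expMoment γ G ≠ ∞ := ((le_self_add.trans hmC).trans_lt hC).ne
  have hc1 : 1 ≤ cStar G - expMoment γ G := ENNReal.le_sub_of_add_le_left hm hmC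
  have hε2 : ε / 2 ≠ 0 := by simpa using hε
  obtain ⟨A, hA, -, hR⟩ := hG.exists_setLIntegral_tail_le hC 0 hε2
  set c := cStar G - expMoment γ G
  set ρ := c + ε with hρ
  have hρ1 : 1 ≤ ρ := hc1.trans le_self_add
  have hρhalf : ρ = (c + ε / 2) + ε / 2 := by rw [add_assoc, ENNReal.add_halves]
  obtain ⟨D, hD, hDb⟩ := hG.exists_shift_bound A
  obtain ⟨N, hN⟩ := eventually_atTop.1 (hR.and hDb)
  -- `K` is chosen so large that `(c + ε / 2) K ρ ^ k + D ≤ K ρ ^ (k + 1)`, and that the bound is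
  -- trivial to the left of `N`
  set K := 1 + (tail G N)⁻¹ + D / (ε / 2) with hK
  have hKtop : K ≠ ∞ := by
    have h1 := ENNReal.div_ne_top hD hε2
    have h2 : (tail G N)⁻¹ ≠ ∞ := by simp [(hG.tail_pos N).ne']
    finiteness
  have hDK : D ≤ ε / 2 * K := by
    rcases eq_or_ne (ε / 2) ∞ with h | hεt
    · rw [h, ENNReal.top_mul (by simp [hK])]
      exact le_top
    · calc D = ε / 2 * (D / (ε / 2)) := (ENNReal.mul_div_cancel hε2 hεt).symm
        _ ≤ ε / 2 * K := by gcongr; exact le_add_self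
  refine ⟨K, hKtop, fun k => ?_⟩
  suffices h : ∀ x, tail (convPow G (k + 1)) x ≤ K * ρ ^ k * tail G x by
    intro x
    refine (h x).trans ?_
    gcongr
    exact Nat.le_succ k
  induction k with
  | zero =>
    intro x
    rw [zero_add, convPow_one, pow_zero, mul_one, hK, add_assoc, add_mul, one_mul]
    exact le_self_add
  | succ k ih =>
    intro x
    rcases le_total N x with hx | hx
    · obtain ⟨hx1, hx2⟩ := hN x hx
      rw [convPow, tail_conv_split _ G A x]
      have h1 : ∫⁻ y in Iic (x - A), tail (convPow G (k + 1)) (x - y) ∂G ≤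
          K * ρ ^ k * ((c + ε / 2) * tail G x) := by
        calc _ ≤ ∫⁻ y in Iic (x - A), K * ρ ^ k * tail G (x - y) ∂G :=
              lintegral_mono fun y => ih (x - y)
          _ = K * ρ ^ k * ∫⁻ y in Iic (x - A), tail G (x - y) ∂G := by
              rw [lintegral_const_mul _ (by fun_prop)]
          _ ≤ _ := by gcongr
      have h2 : ∫⁻ s, tail G (x - min s A) ∂(convPow G (k + 1)) ≤
          ε / 2 * K * ρ ^ k * tail G x := by
        calc _ ≤ ∫⁻ _, tail G (x - A) ∂(convPow G (k + 1)) :=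
              lintegral_mono fun s => tail_antitone G (by linarith [min_le_right s A])
          _ = tail G (x - A) := by simp
          _ ≤ D * 1 * tail G x := by rwa [mul_one]
          _ ≤ _ := by
            gcongr
            exact one_le_pow₀ hρ1
      calc _ ≤ _ := add_le_add h1 h2
        _ = K * (ρ ^ k * (c + ε / 2 + ε / 2)) * tail G x := by ring
        _ = _ := by rw [← hρhalf, ← pow_succ]
    · calc tail (convPow G (k + 1 + 1)) x ≤ 1 := tail_le_one _ x
        _ = (tail G N)⁻¹ * 1 * tail G N := by
          rw [mul_one, ENNReal.inv_mul_cancel (hG.tail_pos N).ne' (tail_ne_top G N)]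
        _ ≤ _ := by
          gcongr
          · rw [hK, add_right_comm]
            exact le_add_self
          · exact one_le_pow₀ hρ1
          · exact tail_antitone G hx

end RegularTail

/-! ### Dominated sums of tails -/

/-- Summation over the positive integers in consecutive blocks of length `n`. -/
lemma tsum_eq_add_tsum_block {n : ℕ} (hn : 1 ≤ n) (f : ℕ → ℝ≥0∞) :
    ∑' k, f k = f 0 + ∑' m : ℕ, ∑ k ∈ Finset.Icc (m * n + 1) ((m + 1) * n), f k := by
  have hpart : ∀ M : ℕ, ∑ k ∈ Finset.range (M * n + 1), f k =
      f 0 + ∑ m ∈ Finset.range M, ∑ k ∈ Finset.Icc (m * n + 1) ((m + 1) * n), f k := by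
    intro M
    induction M with
    | zero => simp
    | succ M ih =>
      rw [Finset.sum_range_succ _ M, ← add_assoc, ← ih, Finset.range_eq_Ico, Finset.range_eq_Ico,
        ← Finset.Ico_add_one_right_eq_Icc, Finset.sum_Ico_consecutive _ (Nat.zero_le _)]
      nlinarith
  have h1 : Tendsto (fun M : ℕ => M * n + 1) atTop atTop :=
    tendsto_atTop_mono (fun M => (Nat.le_mul_of_pos_right M hn).trans (Nat.le_succ _)) tendsto_id
  refine tendsto_nhds_unique ((ENNReal.tendsto_nat_tsum f).comp h1) ?_
  refine Tendsto.congr (fun M => (hpart M).symm) ?_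
  exact (ENNReal.tendsto_nat_tsum _).const_add (f 0)

/-- Termwise asymptotic inequalities may be summed under a summable domination. -/
lemma eventually_tsum_mul_le {p B : ℕ → ℝ≥0∞} {f u : ℕ → ℝ → ℝ≥0∞} {g : ℝ → ℝ≥0∞}
    (hp : ∑' k, p k ≤ 1) (hsum : ∑' k, p k * B k ≠ ∞)
    (hB : ∀ᶠ x in atTop, ∀ k, f k x ≤ B k * g x)
    (hu : ∀ k, ∀ ε : ℝ≥0∞, ε ≠ 0 → ∀ᶠ x in atTop, f k x ≤ u k x + ε * g x)
    {ε : ℝ≥0∞} (hε : ε ≠ 0) :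
    ∀ᶠ x in atTop, ∑' k, p k * f k x ≤ ∑' k, p k * u k x + ε * g x := by
  have hε2 : ε / 2 ≠ 0 := by simpa using hε
  obtain ⟨N, hN⟩ := ((ENNReal.tendsto_sum_nat_add _ hsum).eventually
    (ge_mem_nhds (pos_iff_ne_zero.2 hε2))).exists
  have hfin : ∀ᶠ x in atTop, ∀ k ∈ Finset.range N, f k x ≤ u k x + ε / 2 * g x :=
    (Finset.eventually_all _).2 fun k _ => hu k _ hε2
  filter_upwards [hB, hfin] with x hx1 hx2
  rw [← ENNReal.summable.sum_add_tsum_nat_add' (k := N)]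
  have h1 : ∑ k ∈ Finset.range N, p k * f k x ≤ ∑' k, p k * u k x + ε / 2 * g x := by
    calc _ ≤ ∑ k ∈ Finset.range N, (p k * u k x + p k * (ε / 2 * g x)) :=
          Finset.sum_le_sum fun k hk => by rw [← mul_add]; gcongr; exact hx2 k hk
      _ = ∑ k ∈ Finset.range N, p k * u k x + (∑ k ∈ Finset.range N, p k) * (ε / 2 * g x) := by
          rw [Finset.sum_add_distrib, Finset.sum_mul]
      _ ≤ ∑' k, p k * u k x + 1 * (ε / 2 * g x) := by
          gcongr
          · exact ENNReal.sum_le_tsum _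
          · exact (ENNReal.sum_le_tsum _).trans hp
      _ = _ := by rw [one_mul]
  have h2 : ∑' k, p (k + N) * f (k + N) x ≤ ε / 2 * g x := by
    calc _ ≤ ∑' k, p (k + N) * B (k + N) * g x :=
          ENNReal.tsum_le_tsum fun k => by rw [mul_assoc]; gcongr; exact hx1 _
      _ = (∑' k, p (k + N) * B (k + N)) * g x := ENNReal.tsum_mul_right
      _ ≤ _ := by gcongr
  calc _ ≤ _ := add_le_add h1 h2
    _ = _ := by rw [add_assoc, ← add_mul, ENNReal.add_halves]

/-! ### Random convolutions -/

lemma tsum_measure_eq_one {Ω : Type*} [MeasurableSpace Ω] (P : Measure Ω)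
    [IsProbabilityMeasure P] {τ : Ω → ℕ} (hτ : Measurable τ) : ∑' k, P {ω | τ ω = k} = 1 := by
  have h := measure_iUnion (μ := P) (f := fun k => {ω | τ ω = k})
    (fun i j hij => disjoint_left.2 fun ω hi hj => hij (hi.symm.trans hj))
    (fun k => hτ (measurableSet_singleton k))
  rw [← h, ← measure_univ (μ := P)]
  congr 1
  ext ω
  simp

lemma exists_measure_ne_zero {Ω : Type*} [MeasurableSpace Ω] {P : Measure Ω} {τ : Ω → ℕ} {n : ℕ}
    (h : 0 < P {ω | n ≤ τ ω}) :
    ∃ k, n ≤ k ∧ P {ω | τ ω = k} ≠ 0 := by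
  by_contra! hc
  refine h.ne' (measure_mono_null (t := ⋃ k : ℕ, {ω | n ≤ k ∧ τ ω = k}) ?_
    (measure_iUnion_null fun k => ?_))
  · intro ω hω
    exact mem_iUnion.2 ⟨τ ω, hω, rfl⟩
  · by_cases hk : n ≤ k
    · simpa [hk] using hc k hk
    · simp [hk]

lemma tail_randomConv {Ω : Type*} [MeasurableSpace Ω] (P : Measure Ω) (τ : Ω → ℕ) (F : Measure ℝ)
    (x : ℝ) :
    tail (randomConv P τ F) x = ∑' k, P {ω | τ ω = k} * tail (convPow F k) x := by
  rw [tail, randomConv, Measure.sum_apply _ measurableSet_Ioi]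
  rfl

lemma isHalfLineDist_randomConv {Ω : Type*} [MeasurableSpace Ω] (P : Measure Ω)
    [IsProbabilityMeasure P] {τ : Ω → ℕ} (hτ : Measurable τ) {F : Measure ℝ} (hF : IsHalfLineDist F) :
    IsHalfLineDist (randomConv P τ F) := by
  have := hF.prob
  refine ⟨⟨?_⟩, ?_⟩
  · rw [randomConv, Measure.sum_apply _ MeasurableSet.univ]
    simpa using tsum_measure_eq_one P hτ
  · rw [randomConv, Measure.sum_apply _ measurableSet_Iio]
    simp [(isHalfLineDist_convPow hF _).nonneg]

/-! ### From `𝓛(γ)` to comparisons along all real arguments -/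

/-- For shifts in `V`, the limits in the definition of `𝓛(γ)` hold along all real arguments. -/
lemma ClassL.regularTail {γ : ℝ} (hγ : 0 ≤ γ) {G : Measure ℝ} (hL : ClassL γ G)
    {V : AddSubgroup ℝ} (hV : (V : Set ℝ) = argValues γ G) (hGV : ∀ᵐ x ∂G, x ∈ V)
    (hVd : V = ⊤ ∨ ∃ d, 0 < d ∧ V = AddSubgroup.zmultiples d) : RegularTail γ V G where
  index_nonneg := hγ
  dist := hL.dist
  tail_pos := hL.tail_pos
  measurableSet := by
    obtain rfl | ⟨d, -, rfl⟩ := hVd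
    · exact MeasurableSet.univ
    · exact measurableSet_zmultiples d
  ae_mem := hGV
  exists_pos := by
    obtain rfl | ⟨d, hd, rfl⟩ := hVd
    · exact ⟨1, trivial, one_pos⟩
    · exact ⟨d, AddSubgroup.mem_zmultiples d, hd⟩
  tendsto := by
    intro t ht
    obtain ⟨r, hr, hrS⟩ := exists_retraction hVd
    have h1 := hL.tendsto t (by rw [← hV]; exact ht)
    rw [argAtTop, ← hV] at h1
    refine (h1.comp hr).congr fun x => ?_
    have h2 := hrS G hGV x 0 V.zero_mem
    rw [sub_zero, sub_zero] at h2
    rw [Function.comp_apply, hrS G hGV x t ht, h2]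

/-- Since `V` may consist of fewer points than the arguments admissible for `F`, the liminf condition
is first restricted to `V` and then extended to the whole line. -/
lemma TailLiminf.tailLower {γ : ℝ} {F G : Measure ℝ} (h : TailLiminf γ F)
    (hFG : ∀ x, tail F x ≤ tail G x) {V : AddSubgroup ℝ} (hV : (V : Set ℝ) ⊆ argValues γ F)
    (hFV : ∀ᵐ x ∂F, x ∈ V) (hVd : V = ⊤ ∨ ∃ d, 0 < d ∧ V = AddSubgroup.zmultiples d) {t : ℝ}
    (ht : t ∈ V) (ht0 : 0 < t) : TailLower γ t G F := by
  intro ε hε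
  obtain ⟨r, hr, hrS⟩ := exists_retraction hVd
  have hlt : expFactor γ t - ε < expFactor γ t :=
    ENNReal.sub_lt_self (expFactor_ne_top γ t) (expFactor_ne_zero γ t) hε
  have h1 := eventually_lt_of_lt_liminf (hlt.trans_le (h t (hV ht) ht0))
  have h2 : Tendsto r atTop (argAtTop γ F) :=
    hr.mono_right (inf_le_inf_left _ (principal_mono.2 hV))
  filter_upwards [h2.eventually h1] with x hx
  have h3 := hrS F hFV x 0 V.zero_mem
  rw [sub_zero, sub_zero] at h3
  rw [← hrS F hFV x t ht, ← h3] at hx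
  calc expFactor γ t * tail F x ≤ (expFactor γ t - ε + ε) * tail F x := by
        gcongr
        exact le_tsub_add
    _ = (expFactor γ t - ε) * tail F x + ε * tail F x := add_mul _ _ _
    _ ≤ tail F (x - t) + ε * tail G x := by
        gcongr
        · exact ENNReal.mul_le_of_le_div hx.le
        · exact hFG x

/-- A distribution carried by `V` charges short intervals whose length belongs to `V`; if `V` is a
lattice, the length is `0`. -/
lemma exists_short_interval_ne_zero {T : Measure ℝ} (hT : IsHalfLineDist T) {V : AddSubgroup ℝ}
    (hTV : ∀ᵐ x ∂T, x ∈ V) (hVd : V = ⊤ ∨ ∃ d, 0 < d ∧ V = AddSubgroup.zmultiples d) {η : ℝ}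
    (hη : 0 < η) : ∃ h ∈ V, 0 ≤ h ∧ h < η ∧ ∃ a, 0 ≤ a ∧ T (Icc a (a + h)) ≠ 0 := by
  have := hT.prob
  have hne : T univ ≠ 0 := by simp
  obtain rfl | ⟨d, hd, rfl⟩ := hVd
  · refine ⟨η / 2, trivial, by positivity, by linarith, ?_⟩
    by_contra! hc
    refine hne (measure_mono_null (t := Iio 0 ∪ ⋃ k : ℕ, Icc (k * (η / 2)) (k * (η / 2) + η / 2))
      ?_ (measure_union_null hT.nonneg (measure_iUnion_null fun k => hc _ (by positivity))))
    intro x _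
    rcases lt_or_ge x 0 with hx | hx
    · exact Or.inl hx
    · refine Or.inr (mem_iUnion.2 ⟨⌊x / (η / 2)⌋₊, ?_, ?_⟩)
      · exact (le_div_iff₀ (by positivity)).1 (Nat.floor_le (by positivity))
      · have := (Nat.lt_floor_add_one (x / (η / 2))).le
        rw [div_le_iff₀ (by positivity)] at this
        linarith
  · refine ⟨0, AddSubgroup.zero_mem _, le_rfl, hη, ?_⟩
    by_contra! hc
    have hcount : {x : ℝ | x ∈ AddSubgroup.zmultiples d ∧ 0 ≤ x}.Countable :=
      (Set.countable_range fun k : ℤ => k • d).mono fun x hx => hx.1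
    have h0 : T {x : ℝ | x ∈ AddSubgroup.zmultiples d ∧ 0 ≤ x} = 0 :=
      (measure_null_iff_singleton hcount).2 fun x hx => by simpa using hc x hx.2
    obtain ⟨x, hx1, hx2⟩ := ((hTV.and hT.ae_nonneg).and (measure_eq_zero_iff_ae_notMem.1 h0)).exists
    exact hx2 hx1

/-! ### Membership of the random convolution in the two classes -/

lemma tailLower_of_eventually_zero {γ t : ℝ} {G S : Measure ℝ}
    (h : ∀ᶠ x in atTop, tail S x = 0) : TailLower γ t G S := by
  intro ε _
  filter_upwards [h] with x hx
  simp [hx]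

lemma tailUpper_of_eventually_zero {γ t : ℝ} {G S : Measure ℝ}
    (h : ∀ᶠ x in atTop, tail S x = 0) : TailUpper γ t G S := by
  intro ε _
  have h1 : Tendsto (fun x : ℝ => x - t) atTop atTop :=
    tendsto_atTop_add_const_right _ (-t) tendsto_id
  filter_upwards [h1.eventually h] with x hx
  simp [hx]

lemma eventually_tail_dirac_zero : ∀ᶠ x in atTop, tail (Measure.dirac (0 : ℝ)) x = 0 := by
  filter_upwards [eventually_ge_atTop 0] with x hx
  simp [tail, hx]

/-- If `G = F^{*n}` is regular and `F` satisfies the lower comparison, then all convolution powers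
of `F` satisfy both comparisons. -/
lemma RegularTail.compare_convPow {γ : ℝ} {V : AddSubgroup ℝ} {F : Measure ℝ}
    (hF : IsHalfLineDist F) {n : ℕ} (hn : 1 ≤ n) (hG : RegularTail γ V (convPow F n))
    (hC : cStar (convPow F n) < ∞) (hFV : ∀ᵐ x ∂F, x ∈ V)
    (hVd : V = ⊤ ∨ ∃ d, 0 < d ∧ V = AddSubgroup.zmultiples d)
    (hlow : ∀ t ∈ V, 0 < t → TailLower γ t (convPow F n) F) {B : ℕ → ℝ≥0∞}
    (hBtop : ∀ k, B k ≠ ∞) (hB : ∀ k x, tail (convPow F k) x ≤ B k * tail (convPow F n) x)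
    {t : ℝ} (ht : t ∈ V) (ht0 : 0 < t) (k : ℕ) :
    TailLower γ t (convPow F n) (convPow F k) ∧ TailUpper γ t (convPow F n) (convPow F k) := by
  have := hF.prob
  have hm : expMoment γ (convPow F n) < ∞ :=
    (le_self_add.trans hG.expMoment_add_one_le_cStar).trans_lt hC
  have hG2 : ∀ x, tail ((convPow F n).conv (convPow F n)) x ≤
      B (n + n) * tail (convPow F n) x := fun x => by
    rw [← convPow_add]
    exact hB _ x
  have hB1 : ∀ x, tail F x ≤ B 1 * tail (convPow F n) x := fun x => by
    simpa [convPow_one] using hB 1 x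
  have hlower : ∀ j, ∀ t ∈ V, 0 < t → TailLower γ t (convPow F n) (convPow F j) := by
    intro j t ht ht0
    induction j with
    | zero => exact tailLower_of_eventually_zero eventually_tail_dirac_zero
    | succ j ih =>
      exact hG.lower_conv hm (hBtop _) hG2 (hBtop j) (hBtop 1) (hB j) hB1 ht0.le ih (hlow t ht ht0)
  have hupper : TailUpper γ t (convPow F n) F := by
    obtain ⟨j, rfl⟩ := Nat.exists_eq_add_of_le' hn
    refine hG.upper_of_conv_eq hm (hBtop _) hG2 hF (isHalfLineDist_convPow hF j)
      (Measure.conv_comm _ _) hlow (hlower j) (fun η hη => ?_) ht ht0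
    exact exists_short_interval_ne_zero (isHalfLineDist_convPow hF j)
      (ae_mem_convPow hG.measurableSet hFV j) hVd hη
  refine ⟨hlower k t ht ht0, ?_⟩
  induction k with
  | zero => exact tailUpper_of_eventually_zero eventually_tail_dirac_zero
  | succ k ih =>
    exact hG.upper_conv hm (hBtop _) hG2 (hBtop k) (hBtop 1) (hB k) hB1 ht0.le ih hupper

/-- A distribution that satisfies both comparisons and whose tail is bounded below by a multiple of
`Ḡ` is in `𝓛(γ)`. -/
lemma classL_of_compare {γ : ℝ} {V : AddSubgroup ℝ} {G H : Measure ℝ} (hH : IsHalfLineDist H)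
    (hpos : ∀ x, 0 < tail H x) (hV : argValues γ H ⊆ V) {q : ℝ≥0∞} (hq0 : q ≠ 0)
    (hGH : ∀ x, q * tail G x ≤ tail H x)
    (hcomp : ∀ t ∈ V, 0 < t → TailLower γ t G H ∧ TailUpper γ t G H) : ClassL γ H := by
  have := hH.prob
  have hmain : ∀ t ∈ V, 0 < t →
      Tendsto (fun x => tail H (x - t) / tail H x) atTop (𝓝 (expFactor γ t)) := by
    intro t ht ht0
    refine (ENNReal.tendsto_nhds (expFactor_ne_top γ t)).2 fun ε hε => ?_
    have hδ : ε * q ≠ 0 := mul_ne_zero hε.ne' hq0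
    filter_upwards [(hcomp t ht ht0).1 _ hδ, (hcomp t ht ht0).2 _ hδ] with x hx1 hx2
    have h0 := (hpos x).ne'
    have htop := tail_ne_top H x
    have hle : ε * q * tail G x ≤ ε * tail H x := by
      rw [mul_assoc]
      gcongr
      exact hGH x
    constructor
    · rw [tsub_le_iff_right, ← ENNReal.mul_le_mul_iff_left h0 htop, add_mul,
        ENNReal.div_mul_cancel h0 htop]
      exact hx1.trans (by gcongr)
    · refine ENNReal.div_le_of_le_mul ?_
      rw [add_mul]
      exact hx2.trans (by gcongr)
  refine ⟨hH, hpos, fun t ht => Tendsto.mono_left ?_ inf_le_left⟩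
  have htV : t ∈ V := hV ht
  rcases lt_trichotomy t 0 with ht0 | rfl | ht0
  · have h1 := (hmain (-t) (V.neg_mem htV) (by linarith)).comp
      (tendsto_atTop_add_const_right atTop (-t) tendsto_id)
    have h2 := tendsto_inv_iff.2 h1
    have h3 : (expFactor γ (-t))⁻¹ = ENNReal.ofReal (Real.exp (γ * t)) := by
      rw [expFactor, ← ENNReal.ofReal_inv_of_pos (Real.exp_pos _), ← Real.exp_neg]
      congr 2
      ring
    rw [h3] at h2
    refine h2.congr fun x => ?_
    simp only [Function.comp_apply, id_eq, sub_neg_eq_add, neg_add_cancel_right]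
    rw [ENNReal.inv_div (Or.inl (tail_ne_top H _)) (Or.inl (hpos _).ne'), sub_eq_add_neg]
  · simp only [sub_zero, mul_zero, Real.exp_zero, ENNReal.ofReal_one]
    exact tendsto_const_nhds.congr fun x =>
      (ENNReal.div_self (hpos x).ne' (tail_ne_top H x)).symm
  · exact hmain t htV ht0

/-- A tail that is equivalent up to constants to a tail in `𝓞𝓢` is in `𝓞𝓢`. -/
lemma classOS_of_tail_le {G H : Measure ℝ} (hG : IsHalfLineDist G) (hH : IsHalfLineDist H)
    (hpos : ∀ x, 0 < tail H x) {K C q : ℝ≥0∞} (hK : K ≠ ∞) (hC : C ≠ ∞) (hq0 : q ≠ 0) (hq : q ≠ ∞)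
    (hG2 : ∀ x, tail (G.conv G) x ≤ K * tail G x) (hHG : ∀ x, tail H x ≤ C * tail G x)
    (hGH : ∀ x, q * tail G x ≤ tail H x) : ClassOS H := by
  have := hG.prob
  have := hH.prob
  refine ⟨hH, hpos, ?_⟩
  have hle : ∀ x, tail (convPow H 2) x / tail H x ≤ C * C * K / q := by
    intro x
    refine ENNReal.div_le_of_le_mul ?_
    calc tail (convPow H 2) x = tail (H.conv H) x := by rw [convPow_two]
      _ ≤ C * tail (G.conv H) x := tail_conv_le_mul H hHG x
      _ = C * tail (H.conv G) x := by rw [Measure.conv_comm]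
      _ ≤ C * (C * tail (G.conv G) x) := by gcongr; exact tail_conv_le_mul G hHG x
      _ ≤ C * (C * (K * tail G x)) := by gcongr; exact hG2 x
      _ = C * C * K / q * (q * tail G x) := by
        rw [← mul_assoc (C * C * K / q), ENNReal.div_mul_cancel hq0 hq]
        ring
      _ ≤ _ := by gcongr; exact hGH x
  refine lt_of_le_of_lt ?_ (lt_top_iff_ne_top.2 (ENNReal.div_ne_top (by finiteness) hq0) :
    C * C * K / q < ∞)
  exact limsup_le_of_le (h := .of_forall hle)

end ConvTail

theorem theorem2p4 (F : Measure ℝ) (hF : ConvTail.IsHalfLineDist F)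
    (n : ℕ) (hn : 1 ≤ n) (γ : ℝ) (hγ : 0 ≤ γ)
    (hL : ConvTail.ClassL γ (ConvTail.convPow F n))
    (hOS : ConvTail.ClassOS (ConvTail.convPow F n))
    {Ω : Type*} [MeasurableSpace Ω] (P : Measure Ω) [IsProbabilityMeasure P]
    (τ : Ω → ℕ) (hτ : Measurable τ) (hτn : 0 < P {ω | n ≤ τ ω})
    (ε₀ : ℝ) (hε₀ : 0 < ε₀)
    -- the sum over `m ≥ 1` is written with `m + 1` in place of `m`
    (hsum : ∑' m : ℕ, (∑ k ∈ Finset.Icc (m * n + 1) ((m + 1) * n), P {ω | τ ω = k}) *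
        (ConvTail.cStar (ConvTail.convPow F n) - ConvTail.expMoment γ (ConvTail.convPow F n)
          + ENNReal.ofReal ε₀) ^ (m + 1) < ∞)
    (hcond : (∀ i : ℕ, 1 ≤ i → i < n → ConvTail.TailLiminf γ (ConvTail.convPow F i)) ∨
      ConvTail.TailLittleO F) :
    ConvTail.ClassL γ (ConvTail.randomConv P τ F) ∧
    ConvTail.ClassOS (ConvTail.randomConv P τ F) ∧
    limsup (fun x => ConvTail.tail (ConvTail.randomConv P τ F) x /
        ConvTail.tail (ConvTail.convPow F n) x) atTop ≤
      ∑' m : ℕ, (∑ k ∈ Finset.Icc (m * n + 1) ((m + 1) * n), P {ω | τ ω = k}) *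
        ∑ i ∈ Finset.range (m + 1),
          ConvTail.expMoment γ (ConvTail.convPow F n) ^ i *
            (ConvTail.cStar (ConvTail.convPow F n) -
              ConvTail.expMoment γ (ConvTail.convPow F n)) ^ (m - i) := by
  open ConvTail in
  have := hF.prob
  obtain ⟨V, hV, hGV, hVcases⟩ := exists_argValues_subgroup γ (convPow F n)
  have hVd : V = ⊤ ∨ ∃ d, 0 < d ∧ V = AddSubgroup.zmultiples d := by
    obtain h | ⟨-, d, hd, h⟩ := hVcases
    · exact Or.inl h
    · exact Or.inr ⟨d, hd.pos, h⟩
  have hG : RegularTail γ V (convPow F n) := hL.regularTail hγ hV hGV hVd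
  have hC := hOS.cStar_lt_top
  have hm : expMoment γ (convPow F n) < ∞ :=
    (le_self_add.trans hG.expMoment_add_one_le_cStar).trans_lt hC
  have hFpos := tail_pos_of_convPow hF hL.tail_pos
  have hn0 : n ≠ 0 := by omega
  -- the second alternative is incompatible with the assumptions on `F^{*n}`
  replace hcond : 2 ≤ n → TailLiminf γ F := by
    intro hn2
    rcases hcond with h | h
    · simpa [convPow_one] using h 1 le_rfl (by omega)
    · refine (not_tailLittleO hF hγ ?_ (fun s hs => ?_) h).elim
      · rw [expMoment_convPow γ hF] at hm
        exact (ENNReal.pow_lt_top_iff.1 hm).resolve_right hn0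
      · have h1 := hG.expMoment_eq_top hs
        rw [expMoment_convPow _ hF, ENNReal.pow_eq_top_iff] at h1
        exact h1.1
  have hFdV : ∀ d, 0 < γ → HasLatticeSpan (convPow F n) d →
      ∀ᵐ x ∂F, x ∈ AddSubgroup.zmultiples d := by
    intro d hγ0 hd
    rcases hn.eq_or_lt with rfl | hn2
    · rw [convPow_one] at hd
      exact hd.ae_mem
    · exact (hcond hn2).ae_mem_zmultiples hγ0 hF hFpos hn hd
  have hFV : ∀ᵐ x ∂F, x ∈ V := by
    obtain rfl | ⟨hγ0, d, hd, rfl⟩ := hVcases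
    · exact .of_forall fun _ => trivial
    · exact hFdV d hγ0 hd
  have hlow : ∀ t ∈ V, 0 < t → TailLower γ t (convPow F n) F := by
    intro t ht ht0
    rcases hn.eq_or_lt with rfl | hn2
    · have := hG.lower_self ht
      rwa [convPow_one] at this ⊢
    · refine (hcond hn2).tailLower (fun x => ?_) ?_ hFV hVd ht ht0
      · simpa [convPow_one] using tail_convPow_mono hF x hn
      · rw [hV]
        exact hL.argValues_convPow_subset hF
  obtain ⟨K, hK, hKb⟩ := hG.exists_kesten_bound hC (ε := ENNReal.ofReal ε₀) (by simpa using hε₀)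
  set G := convPow F n with hGdef
  set c := cStar G - expMoment γ G with hc
  set ρ := c + ENNReal.ofReal ε₀ with hρ
  set p : ℕ → ℝ≥0∞ := fun k => P {ω | τ ω = k} with hp
  have hp1 : ∑' k, p k = 1 := tsum_measure_eq_one P hτ
  have hctop : c ≠ ∞ := ne_top_of_le_ne_top hC.ne tsub_le_self
  have hρtop : ρ ≠ ∞ := by finiteness
  -- the index of the block that contains `k`, counted from zero
  have hblock : ∀ m, ∀ k ∈ Finset.Icc (m * n + 1) ((m + 1) * n), (k - 1) / n = m := by
    intro m k hk
    rw [Finset.mem_Icc] at hk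
    rw [Nat.div_eq_iff (by omega)]
    constructor
    · omega
    · rw [add_mul] at hk
      omega
  have hpow : ∀ k x, tail (convPow F k) x ≤ tail (convPow G ((k - 1) / n + 1)) x := by
    intro k x
    rw [hGdef, ← convPow_mul]
    refine tail_convPow_mono hF x ?_
    have h1 := Nat.lt_div_mul_add (a := k - 1) (b := n) (by omega)
    rw [add_mul, one_mul]
    omega
  set B : ℕ → ℝ≥0∞ := fun k => K * ρ ^ ((k - 1) / n + 1) with hBdef
  have hBtop : ∀ k, B k ≠ ∞ := fun k => by finiteness
  have hB : ∀ k x, tail (convPow F k) x ≤ B k * tail G x := fun k x => (hpow k x).trans (hKb _ x)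
  have hBsum : ∑' k, p k * B k ≠ ∞ := by
    rw [tsum_eq_add_tsum_block hn]
    have h1 : ∀ m, ∑ k ∈ Finset.Icc (m * n + 1) ((m + 1) * n), p k * B k =
        K * ((∑ k ∈ Finset.Icc (m * n + 1) ((m + 1) * n), p k) * ρ ^ (m + 1)) := by
      intro m
      rw [Finset.sum_mul, Finset.mul_sum]
      refine Finset.sum_congr rfl fun k hk => ?_
      simp only [hBdef, hblock m k hk]
      ring
    simp only [h1, ENNReal.tsum_mul_left]
    have h2 : p 0 ≠ ∞ := measure_ne_top _ _
    have h3 := hBtop 0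
    have h4 := hsum.ne
    finiteness
  have hH := isHalfLineDist_randomConv P hτ hF
  set H := randomConv P τ F with hHdef
  have htail : ∀ x, tail H x = ∑' k, p k * tail (convPow F k) x := tail_randomConv P τ F
  obtain ⟨k₀, hk₀, hpk₀⟩ := exists_measure_ne_zero hτn
  have hq : p k₀ ≠ ∞ := measure_ne_top _ _
  have hGH : ∀ x, p k₀ * tail G x ≤ tail H x := by
    intro x
    rw [htail]
    refine le_trans ?_ (ENNReal.le_tsum k₀)
    gcongr
    exact tail_convPow_mono hF x hk₀
  have hHpos : ∀ x, 0 < tail H x := fun x =>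
    (ENNReal.mul_pos hpk₀ (hL.tail_pos x).ne').trans_le (hGH x)
  have hHG : ∀ x, tail H x ≤ (∑' k, p k * B k) * tail G x := by
    intro x
    rw [htail, ← ENNReal.tsum_mul_right]
    exact ENNReal.tsum_le_tsum fun k => by rw [mul_assoc]; gcongr; exact hB k x
  have hHV : argValues γ H ⊆ V := by
    rw [hV]
    refine hL.argValues_subset_of_ae_mem (fun d hγ0 hd => ?_) (fun r hr => ?_)
    · rw [hHdef, randomConv, Measure.ae_sum_iff]
      exact fun k => Measure.ae_smul_measure
        (ae_mem_convPow (measurableSet_zmultiples d) (hFdV d hγ0 hd) k) _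
    · rw [hHdef, randomConv, Measure.ae_sum_iff] at hr
      have h1 := (Measure.ae_ennreal_smul_measure_iff hpk₀).1 (hr k₀)
      rw [← Nat.add_sub_cancel' hk₀, convPow_add] at h1
      exact exists_ae_sub_mem_left (measurableSet_zmultiples r) h1
  refine ⟨?_, ?_, ?_⟩
  · refine classL_of_compare hH hHpos hHV hpk₀ hGH fun t ht ht0 => ?_
    have hcomp := hG.compare_convPow hF hn hC hFV hVd hlow hBtop hB ht ht0
    constructor
    · intro ε hε
      have h1 := eventually_tsum_mul_le (p := p) (B := fun k => expFactor γ t * B k)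
        (f := fun k x => expFactor γ t * tail (convPow F k) x)
        (u := fun k x => tail (convPow F k) (x - t)) (g := tail G) hp1.le ?_
        (.of_forall fun x k => by rw [mul_assoc]; gcongr; exact hB k x)
        (fun k => (hcomp k).1) hε
      · filter_upwards [h1] with x hx
        rw [htail, htail, ← ENNReal.tsum_mul_left]
        simpa only [mul_left_comm] using hx
      · simp only [mul_left_comm, ENNReal.tsum_mul_left]
        exact ENNReal.mul_ne_top (expFactor_ne_top _ _) hBsum
    · intro ε hε
      obtain ⟨D, hD, hDb⟩ := hG.exists_shift_bound t
      have h1 := eventually_tsum_mul_le (p := p) (B := fun k => D * B k)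
        (f := fun k x => tail (convPow F k) (x - t))
        (u := fun k x => expFactor γ t * tail (convPow F k) x) (g := tail G) hp1.le ?_ ?_
        (fun k => (hcomp k).2) hε
      · filter_upwards [h1] with x hx
        rw [htail, htail, ← ENNReal.tsum_mul_left]
        simpa only [mul_left_comm] using hx
      · simp only [mul_left_comm, ENNReal.tsum_mul_left]
        exact ENNReal.mul_ne_top hD hBsum
      · filter_upwards [hDb] with x hx k
        calc tail (convPow F k) (x - t) ≤ B k * tail G (x - t) := hB k _
          _ ≤ B k * (D * tail G x) := by gcongr
          _ = D * B k * tail G x := by ring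
  · refine classOS_of_tail_le hL.dist hH hHpos (hBtop (n + n)) hBsum hpk₀ hq (fun x => ?_) hHG hGH
    rw [hGdef, ← convPow_add]
    exact hB _ x
  · set a : ℕ → ℝ≥0∞ := fun m => ∑ i ∈ Finset.range (m + 1), expMoment γ G ^ i * c ^ (m - i)
    set b : ℕ → ℝ≥0∞ := fun k => if k = 0 then 0 else a ((k - 1) / n) with hb
    have hbsum : ∑' k, p k * b k =
        ∑' m : ℕ, (∑ k ∈ Finset.Icc (m * n + 1) ((m + 1) * n), p k) * a m := by
      rw [tsum_eq_add_tsum_block hn]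
      simp only [hb, if_pos, mul_zero, zero_add]
      refine tsum_congr fun m => ?_
      rw [Finset.sum_mul]
      refine Finset.sum_congr rfl fun k hk => ?_
      have hk0 : k ≠ 0 := by
        have := (Finset.mem_Icc.1 hk).1
        omega
      rw [if_neg hk0, hblock m k hk]
    have hlim : ∀ k, ∀ ε : ℝ≥0∞, ε ≠ 0 →
        ∀ᶠ x in atTop, tail (convPow F k) x ≤ b k * tail G x + ε * tail G x := by
      intro k ε hε
      by_cases hk : k = 0
      · subst hk
        filter_upwards [eventually_tail_dirac_zero] with x hx
        rw [convPow, hx]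
        exact zero_le
      · filter_upwards [hG.eventually_tail_convPow_le hC ((k - 1) / n) hε] with x hx
        rw [← add_mul]
        simp only [hb, if_neg hk]
        exact (hpow k x).trans hx
    rw [← hbsum]
    refine ENNReal.le_of_forall_pos_le_add fun ε hε _ => ?_
    refine limsup_le_of_le (h := ?_)
    have hε' : (ε : ℝ≥0∞) ≠ 0 := by exact_mod_cast hε.ne'
    filter_upwards [eventually_tsum_mul_le hp1.le hBsum (.of_forall fun x k => hB k x) hlim hε']
      with x hx
    refine ENNReal.div_le_of_le_mul ?_
    rw [htail, add_mul, ← ENNReal.tsum_mul_right]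
    simpa only [mul_assoc] using hx
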